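/- Let $N,M$ be non-negative integers and $L^2=L^2([0,1]^N,\mathbb C^M)$. For a (scalar- or matrix-valued) function $f$ on $[0,1]^N$ and $1\le j\le N$ put $\langle f\rangle_j=\int_{[0,1]^j}f\,dk_1\cdots dk_j$, a function of $\mathbf k_j=(k_{j+1},\dots,k_N)\in[0,1]^{N-j}$ (a constant if $j=N$). Let $\mathcal H$ be the set of all bounded operators on $L^2$ of the form $$\mathcal A\mathbf u=\mathbf A_0\mathbf u+\mathbf A_1\langle \mathbf B_1\mathbf u\rangle_1+\dots+\mathbf A_N\langle \mathbf B_N\mathbf u\rangle_N,\qquad(1)$$ where $\mathbf A_0,\mathbf A_j,\mathbf B_j$ are continuous matrix-valued functions on $[0,1]^N$ of sizes $M\times M$, $M\times M_j$, $M_j\times M$, with some positive integers $M_j$. Let $\mathcal C=\mathcal C_0\times\dots\times\mathcal C_N$, where $\mathcal C_j$ is the algebra of continuous functions $[0,1]^{N-j}\to\mathbb C$ ($\mathcal C_N=\mathbb C$), with the maximum of the sup norms of the components. For an operator $\mathcal A\in\mathcal H$ that is invertible, define $\boldsymbol\pi(\mathcal A)=(\pi_0,\dots,\pi_N)\in\mathcal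 C$ from a representation (1) by $\pi_0=\det\mathbf A_0$, $\mathbf A_{j,0}=\mathbf A_0^{-1}\mathbf A_j$ for $1\le j\le N$ and, successively for $r=1,\dots,N$, $$\mathbf E_r=\mathbf I+\langle\mathbf B_r\mathbf A_{r,r-1}\rangle_r,\qquad \pi_r=\det\mathbf E_r,\qquad \mathbf A_{j,r}=\mathbf A_{j,r-1}-\mathbf A_{r,r-1}\mathbf E_r^{-1}\langle\mathbf B_r\mathbf A_{j,r-1}\rangle_r\quad(r<j\le N);$$ for invertible $\mathcal A$ all the inverses exist, and $\boldsymbol\pi(\mathcal A)$ does not depend on the representation. For every $\mathcal A\in\mathcal H$ define the trace $$\boldsymbol\tau(\mathcal A)=\frac{\partial}{\partial t}\boldsymbol\pi(\mathcal I+t\mathcal A)\Big|_{t=0}\in\mathcal C ,$$ where $t\in\mathbb C$ and the derivative is taken in the norm of $\mathcal C$. Theorem. For every $\mathcal A\in\mathcal H$ the derivative $\boldsymbol\tau(\mathcal A)$ exists, and for every representation (1) of $\mathcal A$ $$\boldsymbol\tau(\mathcal A)=\bigl(\operatorname{Tr}\mathbf A_0,\langle\operatorname{Tr}\mathbf B_1\mathbf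 A_1\rangle_1,\dots,\langle\operatorname{Tr}\mathbf B_N\mathbf A_N\rangle_N\bigr).$$ Moreover, $\boldsymbol\tau(\alpha\mathcal A+\beta\mathcal B)=\alpha\boldsymbol\tau(\mathcal A)+\beta\boldsymbol\tau(\mathcal B)$ and $\boldsymbol\tau(\mathcal A\circ\mathcal B)=\boldsymbol\tau(\mathcal B\circ\mathcal A)$ for all $\mathcal A,\mathcal B\in\mathcal H$ and $\alpha,\beta\in\mathbb C$. -/

import Mathlib

open MeasureTheory
open scoped unitInterval

noncomputable section

namespace PeriodicOp

/-! ### The cube and its faces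

The coordinates are numbered `0, …, N - 1`.  An index `j : Fin N` stands for the `(j + 1)`-st
averaging operation, the integration over the coordinates `0, …, j`. -/

/-- The cube `[0,1]^N`. -/
abbrev Cube (N : ℕ) : Type := Fin N → I

/-- The values of the coordinates `i > j`, which survive the `(j + 1)`-st averaging
(for `j = N - 1` this is a one-point space). -/
abbrev Rest {N : ℕ} (j : Fin N) : Type := {i : Fin N // j < i} → I

/-- The values of the coordinates `i ≤ j`, over which the `(j + 1)`-st averaging integrates. -/
abbrev First {N : ℕ} (j : Fin N) : Type := {i : Fin N // ¬ j < i} → I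

/-- The point of the cube with prescribed coordinates `i > j` and `i ≤ j`. -/
def glue {N : ℕ} (j : Fin N) (k : Rest j) (s : First j) : Cube N :=
  fun i => if h : j < i then k ⟨i, h⟩ else s ⟨i, h⟩

/-- Forget the coordinates `i ≤ j`. -/
def rest {N : ℕ} (j : Fin N) (k : Cube N) : Rest j := fun i => k i

lemma continuous_glue {N : ℕ} (j : Fin N) :
    Continuous (fun p : Rest j × First j => glue j p.1 p.2) := by
  refine continuous_pi fun i => ?_
  by_cases h : j < i
  · simp only [glue, h, dite_true]; fun_prop
  · simp only [glue, h, dite_false]; fun_prop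

lemma continuous_rest {N : ℕ} (j : Fin N) : Continuous (rest j) := by
  unfold rest; fun_prop

/-! ### Continuous matrix-valued functions -/

/-- Continuous `a × b` matrix-valued functions on `X`. -/
abbrev MatFun (X : Type) [TopologicalSpace X] (a b : ℕ) : Type :=
  C(X, Matrix (Fin a) (Fin b) ℂ)

/-- The pointwise product of continuous matrix-valued functions. -/
def MatFun.mul {X : Type} [TopologicalSpace X] {a b c : ℕ} (A : MatFun X a b) (B : MatFun X b c) :
    MatFun X a c :=
  ⟨fun k => A k * B k, A.continuous.matrix_mul B.continuous⟩

/-- The pointwise determinant. -/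
def MatFun.det {X : Type} [TopologicalSpace X] {a : ℕ} (A : MatFun X a a) : C(X, ℂ) :=
  ⟨fun k => (A k).det, A.continuous.matrix_det⟩

/-- The pointwise trace. -/
def MatFun.trace {X : Type} [TopologicalSpace X] {a : ℕ} (A : MatFun X a a) : C(X, ℂ) :=
  ⟨fun k => (A k).trace, A.continuous.matrix_trace⟩

/-- A function of the coordinates `i > j`, regarded as a function on the whole cube. -/
def MatFun.lift {N : ℕ} (j : Fin N) {a b : ℕ} (A : MatFun (Rest j) a b) : MatFun (Cube N) a b :=
  ⟨fun k => A (rest j k), A.continuous.comp (continuous_rest j)⟩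

lemma continuous_integral_glue {N : ℕ} (j : Fin N) (f : C(Cube N, ℂ)) :
    Continuous (fun k : Rest j => ∫ s : First j, f (glue j k s)) := by
  have h := continuous_parametric_integral_of_continuous (μ := (volume : Measure (First j)))
    (f := fun (k : Rest j) (s : First j) => f (glue j k s))
    (f.continuous.comp (continuous_glue j)) isCompact_univ
  simpa using h

/-- `⟨f⟩` for a continuous scalar function: the integral over the coordinates `i ≤ j`. -/
def avg {N : ℕ} (j : Fin N) (f : C(Cube N, ℂ)) : C(Rest j, ℂ) :=
  ⟨fun k => ∫ s : First j, f (glue j k s), continuous_integral_glue j f⟩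

/-- `⟨A⟩` for a continuous matrix-valued function: the entrywise integral over the coordinates
`i ≤ j`. -/
def MatFun.avg {N : ℕ} (j : Fin N) {a b : ℕ} (A : MatFun (Cube N) a b) : MatFun (Rest j) a b :=
  ⟨fun k => Matrix.of fun x y => ∫ s : First j, A (glue j k s) x y,
    continuous_matrix fun x y =>
      continuous_integral_glue j ⟨fun k => A k x y, A.continuous.matrix_elem x y⟩⟩

/-! ### The operators on `L²([0,1]^N, ℂ^n)` -/

/-- The Hilbert space `L²([0,1]^N, ℂ^n)`. -/
abbrev L2 (N n : ℕ) : Type := Lp (EuclideanSpace ℂ (Fin n)) 2 (volume : Measure (Cube N))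

/-- The matrix `A k` acting on `ℂ^b`. -/
def MatFun.act {X : Type} [TopologicalSpace X] {a b : ℕ} (A : MatFun X a b) (k : X)
    (v : EuclideanSpace ℂ (Fin b)) : EuclideanSpace ℂ (Fin a) :=
  WithLp.toLp 2 ((A k).mulVec v.ofLp)

lemma MatFun.continuous_act {X : Type} [TopologicalSpace X] {a b : ℕ} (A : MatFun X a b) :
    Continuous (fun p : X × EuclideanSpace ℂ (Fin b) => A.act p.1 p.2) := by
  unfold MatFun.act
  refine (PiLp.continuous_toLp 2 _).comp ?_
  exact (A.continuous.comp continuous_fst).matrix_mulVec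
    ((PiLp.continuous_ofLp 2 _).comp continuous_snd)

open scoped Matrix.Norms.L2Operator in
lemma MatFun.exists_bound {X : Type} [TopologicalSpace X] [CompactSpace X] {a b : ℕ}
    (A : MatFun X a b) : ∃ c : ℝ, ∀ k v, ‖A.act k v‖ ≤ c * ‖v‖ := by
  have hA : Continuous fun k => ‖A k‖ := A.continuous.norm
  obtain ⟨c, hc⟩ := (isCompact_range hA).bddAbove
  refine ⟨c, fun k v => (Matrix.l2_opNorm_mulVec (A k) v).trans ?_⟩
  gcongr
  exact hc ⟨k, rfl⟩

lemma MatFun.memLp {N a b : ℕ} (A : MatFun (Cube N) a b) (u : L2 N b) :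
    MemLp (fun k => A.act k (u k)) 2 (volume : Measure (Cube N)) := by
  obtain ⟨c, hc⟩ := A.exists_bound
  have h : AEStronglyMeasurable (fun k : Cube N => (k, u k)) volume :=
    continuous_id.aestronglyMeasurable.prodMk (Lp.aestronglyMeasurable u)
  have h' : AEStronglyMeasurable (fun k : Cube N => A.act k (u k)) volume :=
    Continuous.comp_aestronglyMeasurable (f := fun k : Cube N => (k, u k)) A.continuous_act h
  exact MemLp.of_le_mul (c := c) (Lp.memLp u) h' (Filter.Eventually.of_forall fun k => hc k (u k))

/-- The operator of multiplication by a continuous matrix-valued function,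
`(A u)(k) = A(k) u(k)`. -/
def mulOp {N a b : ℕ} (A : MatFun (Cube N) a b) : L2 N b →L[ℂ] L2 N a :=
  LinearMap.mkContinuousOfExistsBound
    { toFun := fun u => (A.memLp u).toLp (fun k => A.act k (u k))
      map_add' := fun u v => by
        rw [← MemLp.toLp_add]
        refine MemLp.toLp_congr _ _ ?_
        filter_upwards [Lp.coeFn_add u v] with k hk
        rw [hk]
        simp [MatFun.act, Matrix.mulVec_add]
      map_smul' := fun c u => by
        rw [RingHom.id_apply, ← MemLp.toLp_const_smul]
        refine MemLp.toLp_congr _ _ ?_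
        filter_upwards [Lp.coeFn_smul c u] with k hk
        rw [hk]
        simp [MatFun.act, Matrix.mulVec_smul] }
    (by
      obtain ⟨c, hc⟩ := A.exists_bound
      refine ⟨c, fun u => Lp.norm_le_mul_norm_of_ae_le_mul ?_⟩
      filter_upwards [(A.memLp u).coeFn_toLp] with k hk
      change ‖((A.memLp u).toLp _ : Cube N → _) k‖ ≤ _
      rw [hk]
      exact hc k _)

/-- The average of a function over the coordinates `i ≤ j`, as a function on the cube. -/
def avgFun {N n : ℕ} (j : Fin N) (u : Cube N → EuclideanSpace ℂ (Fin n)) (k : Cube N) :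
    EuclideanSpace ℂ (Fin n) :=
  ∫ s : First j, u (glue j (rest j k) s)

lemma measurePreserving_glue {N : ℕ} (j : Fin N) :
    MeasurePreserving (fun p : Rest j × First j => glue j p.1 p.2) volume volume :=
  (volume_preserving_piEquivPiSubtypeProd (fun _ : Fin N => I) (fun i => j < i)).symm

lemma measurePreserving_rest {N : ℕ} (j : Fin N) :
    MeasurePreserving (rest j) volume volume :=
  measurePreserving_fst.comp
    (volume_preserving_piEquivPiSubtypeProd (fun _ : Fin N => I) (fun i => j < i))

lemma memLp_integral_right {R S E : Type} [MeasurableSpace R] [MeasurableSpace S]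
    [NormedAddCommGroup E] [NormedSpace ℝ E] {μ : Measure R} {ν : Measure S} [SFinite μ]
    [IsProbabilityMeasure ν] {f : R × S → E} (hf : MemLp f 2 (μ.prod ν)) :
    MemLp (fun r => ∫ s, f (r, s) ∂ν) 2 μ ∧
      eLpNorm (fun r => ∫ s, f (r, s) ∂ν) 2 μ ≤ eLpNorm f 2 (μ.prod ν) := by
  have hm : AEStronglyMeasurable (fun r => ∫ s, f (r, s) ∂ν) μ := hf.1.integral_prod_right'
  have hle : eLpNorm (fun r => ∫ s, f (r, s) ∂ν) 2 μ ≤ eLpNorm f 2 (μ.prod ν) := by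
    rw [eLpNorm_eq_lintegral_rpow_enorm_toReal (by norm_num) (by norm_num),
      eLpNorm_eq_lintegral_rpow_enorm_toReal (by norm_num) (by norm_num)]
    refine ENNReal.rpow_le_rpow ?_ (by positivity)
    rw [lintegral_prod _ (hf.1.enorm.pow_const _)]
    refine lintegral_mono_ae ?_
    filter_upwards [hf.1.prodMk_left] with r hr
    have h1 := eLpNorm_le_eLpNorm_of_exponent_le (μ := ν) (p := 1) (q := 2) (by norm_num) hr
    rw [eLpNorm_one_eq_lintegral_enorm,
      eLpNorm_eq_lintegral_rpow_enorm_toReal (by norm_num) (by norm_num)] at h1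
    calc _ ≤ (∫⁻ s, ‖f (r, s)‖ₑ ∂ν) ^ (2 : ENNReal).toReal := by
          gcongr; exact enorm_integral_le_lintegral_enorm _
      _ ≤ _ := by
          refine (ENNReal.rpow_le_rpow h1 (by positivity)).trans ?_
          rw [← ENNReal.rpow_mul]
          simp
  exact ⟨⟨hm, hle.trans_lt hf.2⟩, hle⟩

lemma memLp_avgFun {N n : ℕ} (j : Fin N) (u : L2 N n) :
    MemLp (avgFun j u) 2 (volume : Measure (Cube N)) ∧
      eLpNorm (avgFun j u) 2 (volume : Measure (Cube N)) ≤ eLpNorm u 2 volume := by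
  have hu := (Lp.memLp u).comp_measurePreserving (measurePreserving_glue j)
  obtain ⟨h1, h2⟩ := memLp_integral_right hu
  refine ⟨h1.comp_measurePreserving (measurePreserving_rest j), ?_⟩
  have e1 := eLpNorm_comp_measurePreserving (p := 2) h1.1 (measurePreserving_rest j)
  have e2 := eLpNorm_comp_measurePreserving (p := 2) (Lp.memLp u).1 (measurePreserving_glue j)
  exact (e1.le.trans h2).trans e2.le

lemma ae_integrable_glue {N n : ℕ} (j : Fin N) (u : L2 N n) :
    ∀ᵐ k : Cube N, Integrable fun s : First j => u (glue j (rest j k) s) := by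
  have hu : Integrable (fun p : Rest j × First j => u (glue j p.1 p.2)) (volume.prod volume) :=
    ((Lp.memLp u).comp_measurePreserving (measurePreserving_glue j)).integrable one_le_two
  exact (measurePreserving_rest j).quasiMeasurePreserving.ae hu.prod_right_ae

lemma ae_ae_glue {N : ℕ} (j : Fin N) {p : Cube N → Prop} (h : ∀ᵐ k, p k) :
    ∀ᵐ k : Cube N, ∀ᵐ s : First j, p (glue j (rest j k) s) :=
  (measurePreserving_rest j).quasiMeasurePreserving.ae
    (Measure.ae_ae_of_ae_prod ((measurePreserving_glue j).quasiMeasurePreserving.ae h))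

/-- The integral operator `u ↦ ⟨u⟩` on `L²([0,1]^N, ℂ^n)`: integration over the coordinates
`i ≤ j`. -/
def avgOp {N n : ℕ} (j : Fin N) : L2 N n →L[ℂ] L2 N n :=
  LinearMap.mkContinuous
    { toFun := fun u => (memLp_avgFun j u).1.toLp (avgFun j u)
      map_add' := fun u v => by
        rw [← MemLp.toLp_add]
        refine MemLp.toLp_congr _ _ ?_
        filter_upwards [ae_ae_glue j (Lp.coeFn_add u v), ae_integrable_glue j u,
          ae_integrable_glue j v] with k hk hu hv
        simp only [avgFun, Pi.add_apply]
        rw [integral_congr_ae hk]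
        exact integral_add hu hv
      map_smul' := fun c u => by
        rw [RingHom.id_apply, ← MemLp.toLp_const_smul]
        refine MemLp.toLp_congr _ _ ?_
        filter_upwards [ae_ae_glue j (Lp.coeFn_smul c u)] with k hk
        simp only [avgFun, Pi.smul_apply]
        rw [integral_congr_ae hk]
        exact integral_smul c _ }
    1 (fun u => by
      rw [one_mul]
      change ‖(memLp_avgFun j u).1.toLp (avgFun j u)‖ ≤ ‖u‖
      rw [Lp.norm_toLp, Lp.norm_def]
      exact ENNReal.toReal_mono (Lp.eLpNorm_ne_top u) (memLp_avgFun j u).2)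

/-- The data of an expression
`A₀ u + A₁ ⟨B₁ u⟩₁ + … + A_N ⟨B_N u⟩_N`:
continuous matrix-valued functions on `[0,1]^N`, where `A₀` has size `M × M`, `A_j` has size
`M × M_j` and `B_j` has size `M_j × M`.  The `(j + 1)`-st summand is indexed by `j : Fin N`. -/
structure Rep (N M : ℕ) where
  /-- the inner sizes `M_j` -/
  size : Fin N → ℕ
  size_pos : ∀ j, 0 < size j
  A₀ : MatFun (Cube N) M M
  A : ∀ j : Fin N, MatFun (Cube N) M (size j)
  B : ∀ j : Fin N, MatFun (Cube N) (size j) M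

namespace Rep

variable {N M : ℕ}

/-- The operator `A₀ · + A₁ ⟨B₁ ·⟩₁ + … + A_N ⟨B_N ·⟩_N` on `L²([0,1]^N, ℂ^M)`. -/
def op (R : Rep N M) : L2 N M →L[ℂ] L2 N M :=
  mulOp R.A₀ + ∑ j : Fin N, (mulOp (R.A j)).comp ((avgOp j).comp (mulOp (R.B j)))

/-- The matrix `I + ⟨B_j A⟩_j`. -/
def E (R : Rep N M) (j : Fin N) (A : MatFun (Cube N) M (R.size j)) :
    MatFun (Rest j) (R.size j) (R.size j) :=
  1 + MatFun.avg j ((R.B j).mul A)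

/-- The successive functions `A_{j,r}` of the elimination procedure (the `r`-th averaging and the
`r`-th summand, `r = 1, …, N`, have the index `r - 1 : Fin N`):
`A_{j,0} = A₀⁻¹ A_j` and
`A_{j,r} = A_{j,r-1} - A_{r,r-1} E_r⁻¹ ⟨B_r A_{j,r-1}⟩_r` with `E_r = I + ⟨B_r A_{r,r-1}⟩_r`
(they are of interest for `j > r` only).
The inverses are those of the rings of continuous matrix-valued functions, that is, they are
pointwise inverses whenever the determinant vanishes nowhere. -/
def stage (R : Rep N M) : ℕ → (j : Fin N) → MatFun (Cube N) M (R.size j)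
  | 0, j => (Ring.inverse R.A₀).mul (R.A j)
  | r + 1, j =>
    if h : r < N then
      R.stage r j -
        ((R.stage r ⟨r, h⟩).mul
          (MatFun.lift ⟨r, h⟩ (Ring.inverse (R.E ⟨r, h⟩ (R.stage r ⟨r, h⟩))))).mul
          (MatFun.lift ⟨r, h⟩ (MatFun.avg ⟨r, h⟩ ((R.B ⟨r, h⟩).mul (R.stage r j))))
    else R.stage r j

end Rep

/-- The algebra `𝒞 = 𝒞₀ × 𝒞₁ × … × 𝒞_N`, where `𝒞_j` consists of the continuous functions
`[0,1]^{N-j} → ℂ` of the last `N - j` coordinates, with componentwise operations and the maximum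
of the sup norms. -/
abbrev FunVec (N : ℕ) : Type := C(Cube N, ℂ) × (∀ j : Fin N, C(Rest j, ℂ))

namespace Rep

variable {N M : ℕ}

/-- `(π₀, …, π_N)` computed from given data:
`π₀ = det A₀` and `π_j = det E_j` with `E_j = I + ⟨B_j A_{j,j-1}⟩_j`. -/
def det (R : Rep N M) : FunVec N :=
  (R.A₀.det, fun j => (R.E j (R.stage j j)).det)

/-- `(Tr A₀, ⟨Tr B₁ A₁⟩₁, …, ⟨Tr B_N A_N⟩_N)`. -/
def trace (R : Rep N M) : FunVec N :=
  (R.A₀.trace, fun j => avg j ((R.B j).mul (R.A j)).trace)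

end Rep

/-- The set `ℋ` of all operators of the form
`A₀ · + A₁ ⟨B₁ ·⟩₁ + … + A_N ⟨B_N ·⟩_N` on `L²([0,1]^N, ℂ^M)`. -/
def opSet (N M : ℕ) : Set (L2 N M →L[ℂ] L2 N M) := Set.range Rep.op

open scoped Classical in
/-- The determinant `π : Inv(ℋ) → 𝒞`, computed from some representation of the operator
(the value outside of `Inv(ℋ)` is irrelevant). -/
def det {N M : ℕ} (T : L2 N M →L[ℂ] L2 N M) : FunVec N :=
  if h : T ∈ opSet N M ∧ IsUnit T then (h.1.choose).det else 0

/-- The trace `τ(T) = ∂/∂t π(I + t T)` at `t = 0`, with `t ∈ ℂ` and the derivative in the normed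
space `𝒞`. -/
def trace {N M : ℕ} (T : L2 N M →L[ℂ] L2 N M) : FunVec N :=
  deriv (fun t : ℂ => det (1 + t • T)) 0

end PeriodicOp

end

/-!
Write `T_r = A₀ + A₁ ⟨B₁ ·⟩₁ + … + A_r ⟨B_r ·⟩_r` for the partial sums of a representation, acting
on continuous functions (`Rep.partialOp`).

**Independence of the representation.** The determinant `det` is computed from a representation
that is chosen anew for every operator, so it has to be shown that the choice does not matter. The
operator `T = T_N` determines all the partial sums (`Rep.partialOp_eq_of_op_eq`): multiplying `u`
by functions that concentrate on a hyperplane `k_r = p_r` makes the `r`-th average vanish in the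
limit, while the preceding averages do not integrate over `k_r` and only see a factor equal to `1`
at `p`. The elimination procedure computes `A_{j,r} = T_r⁻¹ A_j` (`Rep.partialOp_stage`), whence
`T_r = T_{r-1} (1 + A_{r,r-1} ⟨B_r ·⟩_r)` and the operator `A_{r,r-1} ⟨B_r ·⟩_r` depends on `T`
only. By a finite-dimensional lemma in the spirit of `det (1 + AB) = det (1 + BA)`
(`det_one_add_eq_of_intertwining`), so does `π_r = det (I + ⟨B_r A_{r,r-1}⟩_r)`. The induction on
`r` shows at the same time that the elimination works for all representations of `T` if it works
for one (`Rep.det_eq_of_op_eq`).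

**The derivative.** The operator `1 + t T` has the representation with `1 + t A₀`, `t A_j` and
`B_j`. For small `t` all its pivots are close to the identity, and to first order in `t` the
elimination leaves the functions `t A_j` unchanged (`Rep.hasDerivAt_stageAt`). Since the
derivative of `det` at the identity is the trace, this gives the formula for `τ` (`Rep.trace_op`).

**Linearity and the trace property.** Representations can be added by concatenating blocks, so the
formula shows that `τ` is linear. By bilinearity, `τ(T S) = τ(S T)` reduces to multiplication
operators and single summands `A ⟨B ·⟩_i`, `A' ⟨B' ·⟩_j` with `i ≤ j`. Their products are the
single summands `A ⟨B A'⟩_i ⟨B' ·⟩_j` and `A' ⟨⟨B' A⟩_i B ·⟩_j`, whose traces agree as the average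
`⟨·⟩_i` is a self-adjoint conditional expectation (`MatFun.avg_mul_cavg`).
-/

noncomputable section

namespace PeriodicOp

/-! ### Pointwise algebra of matrix-valued functions -/

namespace MatFun

section Algebra

variable {X : Type} [TopologicalSpace X] {a b c d : ℕ}

@[simp] lemma mul_apply (A : MatFun X a b) (B : MatFun X b c) (k : X) : A.mul B k = A k * B k := rfl

lemma mul_assoc (A : MatFun X a b) (B : MatFun X b c) (C : MatFun X c d) :
    (A.mul B).mul C = A.mul (B.mul C) := by
  ext1 k; exact Matrix.mul_assoc (A k) (B k) (C k)

lemma add_mul (A A' : MatFun X a b) (B : MatFun X b c) :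
    (A + A').mul B = A.mul B + A'.mul B := by
  ext1 k; exact Matrix.add_mul (A k) (A' k) (B k)

lemma mul_add (A : MatFun X a b) (B B' : MatFun X b c) :
    A.mul (B + B') = A.mul B + A.mul B' := by
  ext1 k; exact Matrix.mul_add (A k) (B k) (B' k)

@[simp] lemma zero_mul (B : MatFun X b c) : (0 : MatFun X a b).mul B = 0 := by
  ext1 k; exact Matrix.zero_mul (B k)

@[simp] lemma mul_zero (A : MatFun X a b) : A.mul (0 : MatFun X b c) = 0 := by
  ext1 k; exact Matrix.mul_zero (A k)

lemma smul_mul (t : ℂ) (A : MatFun X a b) (B : MatFun X b c) : (t • A).mul B = t • A.mul B := by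
  ext1 k; exact Matrix.smul_mul t (A k) (B k)

lemma mul_smul (t : ℂ) (A : MatFun X a b) (B : MatFun X b c) : A.mul (t • B) = t • A.mul B := by
  ext1 k; exact Matrix.mul_smul (A k) t (B k)

lemma smul_add (t : ℂ) (A B : MatFun X a b) : t • (A + B) = t • A + t • B := by
  ext1 k; exact _root_.smul_add t (A k) (B k)

lemma zero_smul (A : MatFun X a b) : (0 : ℂ) • A = 0 := by
  ext1 k; exact _root_.zero_smul ℂ (A k)

@[simp] lemma one_mul (A : MatFun X a b) : (1 : MatFun X a a).mul A = A := by
  ext1 k; exact Matrix.one_mul (A k)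

lemma mul_eq_mul (A B : MatFun X a a) : A.mul B = A * B := rfl

lemma isUnit_of_isUnit_det {A : MatFun X a a} (h : IsUnit A.det) : IsUnit A := by
  obtain ⟨u, hu⟩ := h
  let V : MatFun X a a := ⟨fun k => (↑u⁻¹ : C(X, ℂ)) k • (A k).adjugate,
    (↑u⁻¹ : C(X, ℂ)).continuous.smul A.continuous.matrix_adjugate⟩
  have hd (k : X) : (↑u⁻¹ : C(X, ℂ)) k * (A k).det = 1 := by
    have h1 : (↑u⁻¹ : C(X, ℂ)) * A.det = 1 := by rw [← hu]; exact u.inv_mul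
    exact congrArg (fun f : C(X, ℂ) => f k) h1
  refine ⟨⟨A, V, ?_, ?_⟩, rfl⟩
  · ext1 k
    change A k * ((↑u⁻¹ : C(X, ℂ)) k • (A k).adjugate) = 1
    rw [Matrix.mul_smul, Matrix.mul_adjugate, smul_smul, hd, one_smul]
  · ext1 k
    change ((↑u⁻¹ : C(X, ℂ)) k • (A k).adjugate) * A k = 1
    rw [Matrix.smul_mul, Matrix.adjugate_mul, smul_smul, hd, one_smul]

lemma isUnit_det {A : MatFun X a a} (h : IsUnit A) : IsUnit A.det := by
  obtain ⟨u, rfl⟩ := h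
  have key : ∀ V W : MatFun X a a, V * W = 1 → V.det * W.det = 1 := fun V W h => by
    ext1 k
    change (V k).det * (W k).det = 1
    rw [← Matrix.det_mul]
    change ((V * W) k).det = 1
    rw [h]
    exact Matrix.det_one
  exact ⟨⟨_, _, key _ _ u.mul_inv, key _ _ u.inv_mul⟩, rfl⟩

end Algebra

end MatFun

/-! ### Averaging as a conditional expectation -/

/-- The coordinates `i ≤ j` of a point of the cube. -/
def first {N : ℕ} (j : Fin N) (k : Cube N) : First j := fun i => k i

lemma measurePreserving_first {N : ℕ} (j : Fin N) :
    MeasurePreserving (first j) volume volume :=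
  measurePreserving_snd.comp
    (volume_preserving_piEquivPiSubtypeProd (fun _ : Fin N => I) (fun i => j < i))

/-- The point of the cube with the coordinates `i > j` of `k` and the coordinates `i ≤ j` of `s`. -/
def mix {N : ℕ} (j : Fin N) (k s : Cube N) : Cube N := fun i => if j < i then k i else s i

lemma glue_rest_first {N : ℕ} (j : Fin N) (k s : Cube N) :
    glue j (rest j k) (first j s) = mix j k s := by
  ext1 i
  by_cases h : j < i <;> simp [glue, rest, first, mix, h]

lemma rest_glue {N : ℕ} (j : Fin N) (q : Rest j) (s : First j) : rest j (glue j q s) = q := by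
  ext1 i
  simp [rest, glue, i.2]

lemma continuous_mix {N : ℕ} (j : Fin N) :
    Continuous (fun p : Cube N × Cube N => mix j p.1 p.2) := by
  refine continuous_pi fun i => ?_
  by_cases h : j < i <;> simp only [mix, h, if_true, if_false] <;> fun_prop

lemma measurePreserving_mix {N : ℕ} (j : Fin N) :
    MeasurePreserving (fun p : Cube N × Cube N => mix j p.1 p.2) volume volume := by
  have e : (fun p : Cube N × Cube N => mix j p.1 p.2) =
      (fun p : Rest j × First j => glue j p.1 p.2) ∘ Prod.map (rest j) (first j) :=
    funext fun p => (glue_rest_first j p.1 p.2).symm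
  rw [e]
  exact (measurePreserving_glue j).comp
    ((measurePreserving_rest j).prod (measurePreserving_first j))

lemma mix_mix {N : ℕ} {i j : Fin N} (hij : i ≤ j) (k s s' : Cube N) :
    mix i (mix j k s) s' = mix j k (mix i s s') := by
  ext1 x
  simp only [mix]
  by_cases h : j < x
  · simp [h, hij.trans_lt h]
  · simp [h]

lemma integrable_comp_glue {N : ℕ} (j : Fin N) (q : Rest j) {f : Cube N → ℂ} (hf : Continuous f) :
    Integrable fun s : First j => f (glue j q s) :=
  (hf.comp ((continuous_glue j).comp (Continuous.prodMk_right q))).integrable_of_hasCompactSupport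
    (HasCompactSupport.of_compactSpace _)

lemma integral_glue_rest {N : ℕ} (j : Fin N) (k : Cube N) {f : Cube N → ℂ} (hf : Continuous f) :
    ∫ s : First j, f (glue j (rest j k) s) = ∫ s : Cube N, f (mix j k s) := by
  simp_rw [← glue_rest_first]
  rw [← (measurePreserving_first j).map_eq,
    integral_map (measurePreserving_first j).measurable.aemeasurable]
  rw [(measurePreserving_first j).map_eq]
  exact (hf.comp ((continuous_glue j).comp
    (Continuous.prodMk_right (rest j k)))).aestronglyMeasurable

namespace MatFun

variable {N a b c : ℕ}

lemma continuous_entry {X : Type} [TopologicalSpace X] (A : MatFun X a b) (x : Fin a) (y : Fin b) :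
    Continuous fun k => A k x y :=
  A.continuous.matrix_elem x y

@[simp] lemma avg_apply (j : Fin N) (A : MatFun (Cube N) a b) (q : Rest j) (x : Fin a) (y : Fin b) :
    MatFun.avg j A q x y = ∫ s : First j, A (glue j q s) x y := rfl

@[simp] lemma lift_apply (j : Fin N) (A : MatFun (Rest j) a b) (k : Cube N) :
    MatFun.lift j A k = A (rest j k) := rfl

lemma lift_injective (j : Fin N) :
    Function.Injective (MatFun.lift j : MatFun (Rest j) a b → MatFun (Cube N) a b) := by
  intro A B h
  ext1 q
  have := congrArg (fun F : MatFun (Cube N) a b => F (glue j q fun _ => 0)) h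
  simpa [rest_glue] using this

lemma lift_mul (j : Fin N) (A : MatFun (Rest j) a b) (B : MatFun (Rest j) b c) :
    MatFun.lift j (A.mul B) = (MatFun.lift j A).mul (MatFun.lift j B) := rfl

lemma lift_add (j : Fin N) (A B : MatFun (Rest j) a b) :
    MatFun.lift j (A + B) = MatFun.lift j A + MatFun.lift j B := rfl

lemma lift_smul (j : Fin N) (t : ℂ) (A : MatFun (Rest j) a b) :
    MatFun.lift j (t • A) = t • MatFun.lift j A := rfl

lemma avg_add (j : Fin N) (A B : MatFun (Cube N) a b) :
    MatFun.avg j (A + B) = MatFun.avg j A + MatFun.avg j B := by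
  ext q x y
  exact integral_add (integrable_comp_glue j q (A.continuous_entry x y))
    (integrable_comp_glue j q (B.continuous_entry x y))

lemma avg_smul (j : Fin N) (t : ℂ) (A : MatFun (Cube N) a b) :
    MatFun.avg j (t • A) = t • MatFun.avg j A := by
  ext q x y
  exact integral_const_mul t _

@[simp] lemma avg_zero (j : Fin N) : MatFun.avg j (0 : MatFun (Cube N) a b) = 0 := by
  ext q x y
  exact integral_zero _ _

@[simp] lemma lift_zero (j : Fin N) : MatFun.lift j (0 : MatFun (Rest j) a b) = 0 := rfl

/-- Factors that depend on the coordinates `i > j` only can be taken out of `⟨·⟩` on the right. -/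
lemma avg_mul_lift (j : Fin N) (A : MatFun (Cube N) a b) (C : MatFun (Rest j) b c) :
    MatFun.avg j (A.mul (MatFun.lift j C)) = (MatFun.avg j A).mul C := by
  ext q x y
  simp only [avg_apply, mul_apply, lift_apply, Matrix.mul_apply, rest_glue]
  rw [integral_finsetSum _ fun z _ =>
    (integrable_comp_glue j q (A.continuous_entry x z)).mul_const _]
  simp_rw [integral_mul_const]

/-- Factors that depend on the coordinates `i > j` only can be taken out of `⟨·⟩` on the left. -/
lemma avg_lift_mul (j : Fin N) (C : MatFun (Rest j) a b) (A : MatFun (Cube N) b c) :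
    MatFun.avg j ((MatFun.lift j C).mul A) = C.mul (MatFun.avg j A) := by
  ext q x y
  simp only [avg_apply, mul_apply, lift_apply, Matrix.mul_apply, rest_glue]
  rw [integral_finsetSum _ fun z _ =>
    (integrable_comp_glue j q (A.continuous_entry z y)).const_mul _]
  simp_rw [integral_const_mul]

/-- The average `⟨A⟩`, regarded as a function on the whole cube: the conditional expectation of `A`
given the coordinates `i > j`. -/
def cavg (j : Fin N) (A : MatFun (Cube N) a b) : MatFun (Cube N) a b :=
  MatFun.lift j (MatFun.avg j A)

lemma cavg_add (j : Fin N) (A B : MatFun (Cube N) a b) : cavg j (A + B) = cavg j A + cavg j B := by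
  rw [cavg, avg_add, lift_add]; rfl

lemma cavg_apply (j : Fin N) (A : MatFun (Cube N) a b) (k : Cube N) (x : Fin a) (y : Fin b) :
    cavg j A k x y = ∫ s : Cube N, A (mix j k s) x y :=
  integral_glue_rest j k (A.continuous_entry x y)

/-- The matrix-valued function `W` depends on the coordinates `i ≥ r` only. -/
def IndepBelow (r : ℕ) (W : MatFun (Cube N) a b) : Prop :=
  ∀ k k' : Cube N, (∀ i : Fin N, r ≤ i → k i = k' i) → W k = W k'

lemma indepBelow_lift (j : Fin N) (C : MatFun (Rest j) a b) :
    IndepBelow (j + 1) (MatFun.lift j C) := by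
  intro k k' h
  rw [lift_apply, lift_apply]
  congr 1
  ext1 i
  exact h i i.2

lemma IndepBelow.mono {r s : ℕ} (hrs : s ≤ r) {W : MatFun (Cube N) a b} (hW : IndepBelow r W) :
    IndepBelow s W :=
  fun k k' h => hW k k' fun i hi => h i (hrs.trans hi)

lemma IndepBelow.exists_lift {j : Fin N} {W : MatFun (Cube N) a b} (hW : IndepBelow (j + 1) W) :
    ∃ C, W = MatFun.lift j C := by
  refine ⟨⟨fun q => W (glue j q fun _ => 0), W.continuous.comp
    ((continuous_glue j).comp (f := fun q => (q, fun _ => 0)) (by fun_prop))⟩, ?_⟩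
  ext1 k
  refine hW _ _ fun i hi => ?_
  have hi : j < i := hi
  simp [glue, rest, hi]

lemma cavg_mul_of_indepBelow (j : Fin N) (A : MatFun (Cube N) a b) {W : MatFun (Cube N) b c}
    (hW : IndepBelow (j + 1) W) : cavg j (A.mul W) = (cavg j A).mul W := by
  obtain ⟨C, rfl⟩ := hW.exists_lift
  rw [cavg, avg_mul_lift, lift_mul]; rfl

/-- The tower property of the conditional expectations. -/
lemma cavg_cavg {i j : Fin N} (hij : i ≤ j) (A : MatFun (Cube N) a b) :
    cavg j (cavg i A) = cavg j A := by
  ext k x y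
  have hc := A.continuous_entry x y
  rw [cavg_apply, cavg_apply]
  simp_rw [cavg_apply, mix_mix hij]
  have hf : Continuous fun s : Cube N => A (mix j k s) x y :=
    hc.comp ((continuous_mix j).comp (Continuous.prodMk_right k))
  have hg := hf.comp (continuous_mix i)
  rw [← integral_prod (f := fun p : Cube N × Cube N => A (mix j k (mix i p.1 p.2)) x y)
    (hg.integrable_of_hasCompactSupport (HasCompactSupport.of_compactSpace _))]
  have h := (measurePreserving_mix (N := N) i)
  have e := integral_map (μ := volume) h.measurable.aemeasurable (f := fun s => A (mix j k s) x y)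
    hf.aestronglyMeasurable
  rw [h.map_eq] at e
  exact e.symm

lemma avg_cavg {i j : Fin N} (hij : i ≤ j) (A : MatFun (Cube N) a b) :
    MatFun.avg j (cavg i A) = MatFun.avg j A :=
  lift_injective j (cavg_cavg hij A)

lemma avg_mul_cavg {i j : Fin N} (hij : i ≤ j) (A : MatFun (Cube N) a b)
    (B : MatFun (Cube N) b c) :
    MatFun.avg j (A.mul (cavg i B)) = MatFun.avg j ((cavg i A).mul B) := by
  rw [← avg_cavg hij (A.mul (cavg i B)), ← avg_cavg hij ((cavg i A).mul B)]
  congr 1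
  rw [cavg, cavg, cavg, avg_mul_lift, cavg, avg_lift_mul]

end MatFun

/-! ### The operators on continuous functions -/

instance : (volume : Measure I).IsOpenPosMeasure where
  open_pos U hU hne h0 := by
    obtain ⟨V, hV, rfl⟩ := isOpen_induced_iff.1 hU
    obtain ⟨x, hx⟩ := hne
    have hc : (x : ℝ) ∈ closure (Set.Ioo (0 : ℝ) 1) := by
      rw [closure_Ioo zero_ne_one]; exact x.2
    have hpos := (hV.inter isOpen_Ioo).measure_ne_zero volume (mem_closure_iff.1 hc V hV hx)
    have hv : volume (Subtype.val ⁻¹' V : Set I) =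
        volume (Subtype.val '' (Subtype.val ⁻¹' V : Set I)) :=
      comap_subtype_coe_apply measurableSet_Icc volume _
    refine hpos (measure_mono_null ?_ (hv.symm.trans h0))
    rintro y ⟨hy, hy'⟩
    exact ⟨⟨y, Set.Ioo_subset_Icc_self hy'⟩, hy, rfl⟩

/-- The column `y` of a continuous matrix-valued function. -/
def column {N n c : ℕ} (U : MatFun (Cube N) n c) (y : Fin c) :
    C(Cube N, EuclideanSpace ℂ (Fin n)) :=
  ⟨fun k => WithLp.toLp 2 fun x => U k x y,
    (PiLp.continuous_toLp 2 _).comp (continuous_pi fun x => U.continuous_entry x y)⟩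

/-- The column `y` of a continuous matrix-valued function, as an element of `L²`. -/
def toL2 {N n c : ℕ} (U : MatFun (Cube N) n c) (y : Fin c) : L2 N n :=
  ContinuousMap.toLp 2 volume ℂ (column U y)

lemma coeFn_toL2 {N n c : ℕ} (U : MatFun (Cube N) n c) (y : Fin c) :
    toL2 U y =ᵐ[volume] fun k => WithLp.toLp 2 fun x => U k x y :=
  ContinuousMap.coeFn_toLp volume _

lemma toL2_injective {N n c : ℕ} {U V : MatFun (Cube N) n c} (h : ∀ y, toL2 U y = toL2 V y) :
    U = V := by
  ext k x y
  have h1 := ContinuousMap.toLp_injective (p := 2) (𝕜 := ℂ) (volume : Measure (Cube N)) (h y)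
  have h2 := congrArg (fun f : C(Cube N, EuclideanSpace ℂ (Fin n)) => f k x) h1
  exact h2

lemma toL2_add {N n c : ℕ} (U V : MatFun (Cube N) n c) (y : Fin c) :
    toL2 (U + V) y = toL2 U y + toL2 V y := by
  have h : column (U + V) y = column U y + column V y := rfl
  rw [toL2, h, map_add]
  rfl

lemma toL2_smul {N n c : ℕ} (t : ℂ) (U : MatFun (Cube N) n c) (y : Fin c) :
    toL2 (t • U) y = t • toL2 U y := by
  have h : column (t • U) y = t • column U y := rfl
  rw [toL2, h, map_smul]
  rfl

lemma toL2_zero {N n c : ℕ} (y : Fin c) : toL2 (0 : MatFun (Cube N) n c) y = 0 := by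
  have h : column (0 : MatFun (Cube N) n c) y = 0 := rfl
  rw [toL2, h, map_zero]

/-- Bounded operators on `L²` agree as soon as they agree on continuous functions. -/
lemma ext_toL2 {N n m : ℕ} {T S : L2 N n →L[ℂ] L2 N m}
    (h : ∀ U : MatFun (Cube N) n 1, T (toL2 U 0) = S (toL2 U 0)) : T = S := by
  have hd := ContinuousMap.toLp_denseRange (E := EuclideanSpace ℂ (Fin n)) (p := 2)
    (volume : Measure (Cube N)) ℂ (by norm_num)
  refine ContinuousLinearMap.coeFn_injective (hd.equalizer T.continuous S.continuous ?_)
  ext1 f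
  let U : MatFun (Cube N) n 1 := ⟨fun k => Matrix.of fun x _ => f k x,
    continuous_matrix fun x _ => (PiLp.continuous_apply 2 _ x).comp f.continuous⟩
  exact h U

lemma mulOp_toL2 {N a b c : ℕ} (A : MatFun (Cube N) a b) (U : MatFun (Cube N) b c) (y : Fin c) :
    mulOp A (toL2 U y) = toL2 (A.mul U) y := by
  refine Lp.ext ?_
  filter_upwards [(A.memLp (toL2 U y)).coeFn_toLp, coeFn_toL2 U y, coeFn_toL2 (A.mul U) y]
    with k h1 h2 h3
  rw [h3]
  refine h1.trans ?_
  rw [h2]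
  rfl

lemma avgOp_toL2 {N n c : ℕ} (j : Fin N) (U : MatFun (Cube N) n c) (y : Fin c) :
    avgOp j (toL2 U y) = toL2 (MatFun.cavg j U) y := by
  refine Lp.ext ?_
  filter_upwards [(memLp_avgFun j (toL2 U y)).1.coeFn_toLp, ae_ae_glue j (coeFn_toL2 U y),
    coeFn_toL2 (MatFun.cavg j U) y] with k h1 h2 h3
  rw [h3]
  refine h1.trans ?_
  rw [avgFun, integral_congr_ae h2]
  ext x
  have hi : Integrable fun s : First j =>
      (WithLp.toLp 2 fun x => U (glue j (rest j k) s) x y : EuclideanSpace ℂ (Fin n)) := by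
    refine Continuous.integrable_of_hasCompactSupport ?_ (HasCompactSupport.of_compactSpace _)
    exact (PiLp.continuous_toLp 2 _).comp (continuous_pi fun x => (U.continuous_entry x y).comp
      ((continuous_glue j).comp (Continuous.prodMk_right (rest j k))))
  exact ((EuclideanSpace.proj x : EuclideanSpace ℂ (Fin n) →L[ℂ] ℂ).integral_comp_comm hi).symm

namespace Rep

variable {N M : ℕ}

/-- The summand `A_j ⟨B_j U⟩_j` on continuous functions. -/
def term (R : Rep N M) (j : Fin N) {c : ℕ} (U : MatFun (Cube N) M c) : MatFun (Cube N) M c :=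
  (R.A j).mul (MatFun.cavg j ((R.B j).mul U))

/-- The partial sum `A₀ U + A₁ ⟨B₁ U⟩₁ + … + A_r ⟨B_r U⟩_r` on continuous functions
(for `r ≥ N` the whole sum). -/
def partialOp (R : Rep N M) : ℕ → {c : ℕ} → MatFun (Cube N) M c → MatFun (Cube N) M c
  | 0, _, U => R.A₀.mul U
  | r + 1, _, U => R.partialOp r U + if h : r < N then R.term ⟨r, h⟩ U else 0

lemma partialOp_succ (R : Rep N M) (j : Fin N) {c : ℕ} (U : MatFun (Cube N) M c) :
    R.partialOp (j + 1) U = R.partialOp j U + R.term j U := by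
  simp [partialOp]

lemma partialOp_eq_sum (R : Rep N M) (r : ℕ) {c : ℕ} (U : MatFun (Cube N) M c) :
    R.partialOp r U =
      R.A₀.mul U + ∑ i ∈ Finset.range r, if h : i < N then R.term ⟨i, h⟩ U else 0 := by
  induction r with
  | zero => simp [partialOp]
  | succ r ih => rw [partialOp, ih, Finset.sum_range_succ, add_assoc]

lemma op_toL2 (R : Rep N M) {c : ℕ} (U : MatFun (Cube N) M c) (y : Fin c) :
    R.op (toL2 U y) = toL2 (R.partialOp N U) y := by
  have hs : ∀ (s : Finset (Fin N)),
      toL2 (∑ j ∈ s, R.term j U) y = ∑ j ∈ s, toL2 (R.term j U) y := fun s => by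
    classical
    induction s using Finset.induction_on with
    | empty => simp [toL2_zero]
    | insert a s ha ih => rw [Finset.sum_insert ha, Finset.sum_insert ha, toL2_add, ih]
  rw [partialOp_eq_sum, Finset.sum_range, toL2_add]
  simp only [Fin.is_lt, dite_true, Fin.eta, hs, op, add_apply,
    sum_apply, ContinuousLinearMap.comp_apply, mulOp_toL2, avgOp_toL2]
  rfl

lemma partialOp_add (R : Rep N M) (r : ℕ) {c : ℕ} (U V : MatFun (Cube N) M c) :
    R.partialOp r (U + V) = R.partialOp r U + R.partialOp r V := by
  induction r with
  | zero => exact MatFun.mul_add _ _ _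
  | succ r ih =>
    by_cases h : r < N
    · simp only [partialOp, ih, h, dite_true, term, MatFun.mul_add, MatFun.cavg_add]
      abel
    · simp [partialOp, ih, h]

lemma partialOp_sub (R : Rep N M) (r : ℕ) {c : ℕ} (U V : MatFun (Cube N) M c) :
    R.partialOp r (U - V) = R.partialOp r U - R.partialOp r V := by
  rw [eq_sub_iff_add_eq, ← partialOp_add, sub_add_cancel]

/-- The first `r` averagings commute with right multiplication by functions of the remaining
coordinates. -/
lemma partialOp_mul (R : Rep N M) {r : ℕ} {c d : ℕ} (U : MatFun (Cube N) M c)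
    {W : MatFun (Cube N) c d} (hW : MatFun.IndepBelow r W) :
    R.partialOp r (U.mul W) = (R.partialOp r U).mul W := by
  induction r with
  | zero => exact (MatFun.mul_assoc _ _ _).symm
  | succ r ih =>
    by_cases h : r < N
    · simp only [partialOp, ih (hW.mono r.le_succ), h, dite_true, term, MatFun.add_mul]
      rw [← MatFun.mul_assoc, MatFun.cavg_mul_of_indepBelow _ _ (by exact hW), MatFun.mul_assoc]
    · simp [partialOp, ih (hW.mono r.le_succ), h]

end Rep

/-! ### The operator determines its partial sums -/

/-- The function `(1 - |k_r - p_r|)^n` times the identity matrix: for large `n` it concentrates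
near the hyperplane `k_r = p_r`. -/
def bump {N : ℕ} (r : Fin N) (p : Cube N) (n c : ℕ) : MatFun (Cube N) c c :=
  ⟨fun k => (((1 - |(k r : ℝ) - p r|) ^ n : ℝ) : ℂ) • (1 : Matrix (Fin c) (Fin c) ℂ), by
    fun_prop⟩

lemma indepBelow_bump {N : ℕ} (r : Fin N) (p : Cube N) (n c : ℕ) :
    MatFun.IndepBelow r (bump r p n c) := by
  intro k k' h
  simp [bump, h r le_rfl]

lemma bump_self {N : ℕ} (r : Fin N) (p : Cube N) (n c : ℕ) : bump r p n c p = 1 := by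
  simp [bump]

lemma abs_sub_le_one (x y : I) : |(x : ℝ) - y| ≤ 1 := by
  rw [abs_le]
  constructor <;> linarith [x.2.1, x.2.2, y.2.1, y.2.2]

/-- The averages of functions concentrating on a hyperplane transversal to the domain of
integration tend to zero. -/
lemma tendsto_avg_mul_bump {N a c : ℕ} (r : Fin N) (p : Cube N) (V : MatFun (Cube N) a c)
    (q : Rest r) :
    Filter.Tendsto (fun n => MatFun.avg r (V.mul (bump r p n c)) q) Filter.atTop (nhds 0) := by
  refine tendsto_pi_nhds.2 fun x => tendsto_pi_nhds.2 fun y => ?_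
  have hb : ∀ n k, (V.mul (bump r p n c)) k x y =
      (((1 - |(k r : ℝ) - p r|) ^ n : ℝ) : ℂ) * V k x y := fun n k => by
    simp [bump]
  change Filter.Tendsto (fun n => ∫ s : First r, (V.mul (bump r p n c)) (glue r q s) x y)
    Filter.atTop (nhds 0)
  have hr (s : First r) : glue r q s r = s ⟨r, lt_irrefl r⟩ := by simp [glue]
  have h01 (s : First r) := abs_sub_le_one (s ⟨r, lt_irrefl r⟩) (p r)
  simp_rw [hb, hr]
  have hV : Continuous fun s : First r => V (glue r q s) x y :=
    (V.continuous_entry x y).comp ((continuous_glue r).comp (Continuous.prodMk_right q))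
  rw [← integral_zero (First r) ℂ]
  refine tendsto_integral_of_dominated_convergence (fun s => ‖V (glue r q s) x y‖) ?_ ?_ ?_ ?_
  · intro n
    exact (Continuous.mul (by fun_prop) hV).aestronglyMeasurable
  · exact (integrable_comp_glue r q (V.continuous_entry x y)).norm
  · refine fun n => Filter.Eventually.of_forall fun s => ?_
    rw [norm_mul]
    refine mul_le_of_le_one_left (norm_nonneg _) ?_
    rw [Complex.norm_real, Real.norm_eq_abs, abs_of_nonneg (pow_nonneg (by linarith [h01 s]) _)]
    exact pow_le_one₀ (by linarith [h01 s])
      (by linarith [abs_nonneg ((s ⟨r, lt_irrefl r⟩ : ℝ) - p r)])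
  · filter_upwards [Measure.ae_eval_ne (μ := fun _ : {i : Fin N // ¬ r < i} => (volume : Measure I))
      ⟨r, lt_irrefl r⟩ (p r)] with s hs
    have hpos : 0 < |(s ⟨r, lt_irrefl r⟩ : ℝ) - p r| :=
      abs_pos.2 (sub_ne_zero.2 fun h => hs (Subtype.ext h))
    have h1 := tendsto_pow_atTop_nhds_zero_of_lt_one (r := 1 - |(s ⟨r, lt_irrefl r⟩ : ℝ) - p r|)
      (by linarith [h01 s]) (by linarith)
    have h2 := (Complex.continuous_ofReal.tendsto 0).comp h1
    simpa using h2.mul_const (V (glue r q s) x y)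

namespace Rep

variable {N M : ℕ}

lemma tendsto_partialOp_bump (R : Rep N M) (r : Fin N) (p : Cube N) {c : ℕ}
    (U : MatFun (Cube N) M c) :
    Filter.Tendsto (fun n => R.partialOp (r + 1) (U.mul (bump r p n c)) p) Filter.atTop
      (nhds (R.partialOp r U p)) := by
  have h : ∀ n, R.partialOp (r + 1) (U.mul (bump r p n c)) p =
      R.partialOp r U p +
        R.A r p * MatFun.avg r (((R.B r).mul U).mul (bump r p n c)) (rest r p) := fun n => by
    rw [partialOp_succ, partialOp_mul _ _ (indepBelow_bump r p n c), term, ← MatFun.mul_assoc]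
    change R.partialOp r U p * bump r p n c p + _ = _
    rw [bump_self, Matrix.mul_one]
    rfl
  simp_rw [h]
  have h2 := ((continuous_const (y := R.A r p)).matrix_mul continuous_id).tendsto 0 |>.comp
    (tendsto_avg_mul_bump r p ((R.B r).mul U) (rest r p))
  simpa using h2.const_add (R.partialOp r U p)

/-- The operator on `L²` determines all the partial sums of its representations: the last
averaging is removed by testing with functions that concentrate on hyperplanes. -/
lemma partialOp_eq_of_op_eq {R R' : Rep N M} (h : R.op = R'.op) {r : ℕ} (hr : r ≤ N) {c : ℕ}
    (U : MatFun (Cube N) M c) : R.partialOp r U = R'.partialOp r U := by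
  induction hr using Nat.decreasingInduction generalizing c with
  | self => exact toL2_injective fun y => by rw [← op_toL2, ← op_toL2, h]
  | of_succ r hr ih =>
    ext1 p
    refine tendsto_nhds_unique (R.tendsto_partialOp_bump ⟨r, hr⟩ p U) ?_
    simp_rw [ih]
    exact R'.tendsto_partialOp_bump ⟨r, hr⟩ p U

end Rep

/-! ### Independence of the representation -/

/-- If `b = BA`, `c = B'A`, `d = BA'`, `e = B'A'` with `AB = A'B'`, then
`det (1 + b) = det (1 + e)`; only the four relations between `b, c, d, e` that follow from
`AB = A'B'` are needed.  The block matrices `F = (b d; 0 0)` and `G = (0 0; c e)` have the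
determinants `det (1 + F) = det (1 + b)` and `det (1 + G) = det (1 + e)`, and `H = F - G` satisfies
`H² = 0` and `1 + G = (1 + F) (1 - H)`. -/
lemma det_one_add_eq_of_intertwining {m m' : ℕ} {b : Matrix (Fin m) (Fin m) ℂ}
    {c : Matrix (Fin m') (Fin m) ℂ} {d : Matrix (Fin m) (Fin m') ℂ}
    {e : Matrix (Fin m') (Fin m') ℂ} (hbb : b * b = d * c) (hbd : b * d = d * e)
    (hcb : c * b = e * c) (hcd : c * d = e * e) : (1 + b).det = (1 + e).det := by
  have hH : Matrix.fromBlocks b d (-c) (-e) * Matrix.fromBlocks b d (-c) (-e) = 0 := by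
    rw [Matrix.fromBlocks_multiply]
    simp [hbb, hbd, hcb, hcd]
  have hnil : (1 - Matrix.fromBlocks b d (-c) (-e)).det = 1 := by
    have h := (Matrix.isNilpotent_charpoly_sub_pow_of_isNilpotent
      (M := Matrix.fromBlocks b d (-c) (-e)) ⟨2, by rw [pow_two, hH]⟩).eq_zero
    have h1 := congrArg (Polynomial.eval 1) (sub_eq_zero.1 h)
    rw [Matrix.eval_charpoly] at h1
    simpa using h1
  have hF : (1 + Matrix.fromBlocks b d 0 0).det = (1 + b).det := by
    rw [← Matrix.fromBlocks_one, Matrix.fromBlocks_add]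
    simp
  have hG : (1 + Matrix.fromBlocks 0 0 c e).det = (1 + e).det := by
    rw [← Matrix.fromBlocks_one, Matrix.fromBlocks_add]
    simp [Matrix.det_fromBlocks_zero₁₂]
  have hprod : 1 + Matrix.fromBlocks 0 0 c e =
      (1 + Matrix.fromBlocks b d 0 0) * (1 - Matrix.fromBlocks b d (-c) (-e)) := by
    have h0 : Matrix.fromBlocks b d 0 (0 : Matrix (Fin m') (Fin m') ℂ) *
        Matrix.fromBlocks b d (-c) (-e) = 0 := by
      rw [Matrix.fromBlocks_multiply]
      simp [hbb, hbd]
    have h1 : Matrix.fromBlocks b d 0 0 - Matrix.fromBlocks b d (-c) (-e) =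
        Matrix.fromBlocks 0 0 c e := by
      rw [sub_eq_add_neg, Matrix.fromBlocks_neg, Matrix.fromBlocks_add]
      simp
    rw [mul_sub, mul_one, add_mul, h0, one_mul, add_zero, ← h1, add_sub_assoc]
  rw [← hF, ← hG, hprod, Matrix.det_mul, hnil, mul_one]

namespace Rep

variable {N M : ℕ}

/-- The matrix-valued function `E_j = I + ⟨B_j A_{j,j-1}⟩_j` of the elimination procedure. -/
def pivot (R : Rep N M) (j : Fin N) : MatFun (Rest j) (R.size j) (R.size j) :=
  R.E j (R.stage j j)

lemma stage_succ (R : Rep N M) (r j : Fin N) :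
    R.stage (r + 1) j = R.stage r j - (R.stage r r).mul
      (MatFun.lift r ((Ring.inverse (R.pivot r)).mul
        (MatFun.avg r ((R.B r).mul (R.stage r j))))) := by
  rw [stage, dif_pos r.2, MatFun.mul_assoc]
  rfl

/-- The elimination procedure can be carried out up to `A_{j,r}`: the matrices `A₀, E₁, …, E_r`
are invertible. -/
def Regular (R : Rep N M) (r : ℕ) : Prop :=
  IsUnit R.A₀ ∧ ∀ j : Fin N, (j : ℕ) < r → IsUnit (R.pivot j)

/-- The partial sum `A₀ + … + A_r ⟨B_r ·⟩_r` is the previous one, composed with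
`1 + A_{r,r-1} ⟨B_r ·⟩_r`. -/
lemma partialOp_succ_eq (R : Rep N M) (r : Fin N) (h : R.partialOp r (R.stage r r) = R.A r) {c : ℕ}
    (U : MatFun (Cube N) M c) :
    R.partialOp (r + 1) U =
      R.partialOp r (U + (R.stage r r).mul (MatFun.cavg r ((R.B r).mul U))) := by
  rw [partialOp_succ, partialOp_add, partialOp_mul, h, term]
  exact (MatFun.indepBelow_lift r _).mono (Nat.le_succ _)

lemma avg_add_stage_mul (R : Rep N M) (r : Fin N) {c : ℕ} (U : MatFun (Cube N) M c)
    (C : MatFun (Rest r) (R.size r) c) :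
    MatFun.avg r ((R.B r).mul (U + (R.stage r r).mul (MatFun.lift r C))) + C =
      MatFun.avg r ((R.B r).mul U) + (R.pivot r).mul C := by
  rw [MatFun.mul_add, MatFun.avg_add, ← MatFun.mul_assoc, MatFun.avg_mul_lift, pivot, E,
    MatFun.add_mul, MatFun.one_mul]
  abel

/-- The functions `A_{j,r}` are the columns of `(A₀ + … + A_r ⟨B_r ·⟩_r)⁻¹ A_j`. -/
lemma partialOp_stage (R : Rep N M) {r : ℕ} (hr : r ≤ N) (h : R.Regular r) (j : Fin N) :
    R.partialOp r (R.stage r j) = R.A j := by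
  induction r generalizing j with
  | zero =>
    rw [partialOp, stage, ← MatFun.mul_assoc, MatFun.mul_eq_mul, Ring.mul_inverse_cancel _ h.1,
      MatFun.one_mul]
  | succ r ih =>
    have ih := ih (r.le_succ.trans hr) ⟨h.1, fun i hi => h.2 i (hi.trans r.lt_succ_self)⟩
    obtain ⟨r, rfl⟩ : ∃ i : Fin N, (i : ℕ) = r := ⟨⟨r, hr⟩, rfl⟩
    rw [partialOp_succ_eq _ _ (ih r), ← ih j]
    congr 1
    set D := MatFun.avg r ((R.B r).mul (R.stage r j)) with hD
    have h1 : MatFun.avg r ((R.B r).mul (R.stage (r + 1) j)) =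
        (Ring.inverse (R.pivot r)).mul D := by
      have h2 := R.avg_add_stage_mul r (R.stage (r + 1) j) ((Ring.inverse (R.pivot r)).mul D)
      rw [← MatFun.mul_assoc, MatFun.mul_eq_mul,
        Ring.mul_inverse_cancel _ (h.2 r r.val.lt_succ_self),
        MatFun.one_mul, stage_succ, sub_add_cancel, ← hD, add_comm] at h2
      rw [stage_succ]
      exact (add_right_cancel h2).symm
    rw [MatFun.cavg, h1, stage_succ, sub_add_cancel]

lemma partialOp_injective (R : Rep N M) {r : ℕ} (hr : r ≤ N) (h : R.Regular r) {c : ℕ}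
    {U : MatFun (Cube N) M c} (hU : R.partialOp r U = 0) : U = 0 := by
  induction r generalizing U with
  | zero =>
    have h1 := congrArg ((Ring.inverse R.A₀).mul) hU
    rwa [partialOp, ← MatFun.mul_assoc, MatFun.mul_eq_mul, Ring.inverse_mul_cancel _ h.1,
      MatFun.one_mul, MatFun.mul_zero] at h1
  | succ r ih =>
    have h' : R.Regular r := ⟨h.1, fun i hi => h.2 i (hi.trans r.lt_succ_self)⟩
    have hr' := r.le_succ.trans hr
    obtain ⟨r, rfl⟩ : ∃ i : Fin N, (i : ℕ) = r := ⟨⟨r, hr⟩, rfl⟩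
    rw [partialOp_succ_eq _ _ (R.partialOp_stage hr' h' r)] at hU
    have h0 := ih hr' h' hU
    have h1 := R.avg_add_stage_mul r U (MatFun.avg r ((R.B r).mul U))
    rw [MatFun.cavg] at h0
    rw [h0, MatFun.mul_zero, MatFun.avg_zero, zero_add] at h1
    have h2 : (R.pivot r).mul (MatFun.avg r ((R.B r).mul U)) = 0 := left_eq_add.1 h1
    have h3 := congrArg ((Ring.inverse (R.pivot r)).mul) h2
    rw [← MatFun.mul_assoc, MatFun.mul_eq_mul,
      Ring.inverse_mul_cancel _ (h.2 r r.val.lt_succ_self),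
      MatFun.one_mul, MatFun.mul_zero] at h3
    rwa [h3, MatFun.lift_zero, MatFun.mul_zero, add_zero] at h0

lemma A₀_eq_of_op_eq {R R' : Rep N M} (h : R.op = R'.op) : R.A₀ = R'.A₀ := by
  have h1 := partialOp_eq_of_op_eq h N.zero_le (1 : MatFun (Cube N) M M)
  have h2 : ∀ A : MatFun (Cube N) M M, A.mul 1 = A := mul_one
  simpa only [partialOp, h2] using h1

/-- Both sides are `(A₀ + … + A_{r-1} ⟨B_{r-1} ·⟩_{r-1})⁻¹ (A₀ + … + A_r ⟨B_r ·⟩_r) - 1`, applied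
to `U`. -/
lemma stage_mul_cavg_eq {R R' : Rep N M} (h : R.op = R'.op) {r : Fin N} (hR : R.Regular r)
    (hR' : R'.Regular r) {c : ℕ} (U : MatFun (Cube N) M c) :
    (R.stage r r).mul (MatFun.cavg r ((R.B r).mul U)) =
      (R'.stage r r).mul (MatFun.cavg r ((R'.B r).mul U)) := by
  have hr : (r : ℕ) ≤ N := r.2.le
  have h1 := partialOp_eq_of_op_eq h (Nat.succ_le_of_lt r.2) U
  rw [Nat.succ_eq_add_one, partialOp_succ_eq _ _ (R.partialOp_stage hr hR r),
    partialOp_succ_eq _ _ (R'.partialOp_stage hr hR' r), ← partialOp_eq_of_op_eq h hr,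
    ← sub_eq_zero, ← partialOp_sub] at h1
  exact add_left_cancel (sub_eq_zero.1 (R.partialOp_injective hr hR h1))

lemma det_pivot_eq {R R' : Rep N M} (h : R.op = R'.op) {r : Fin N} (hR : R.Regular r)
    (hR' : R'.Regular r) : (R.pivot r).det = (R'.pivot r).det := by
  have key {c n : ℕ} (V : MatFun (Cube N) n M) (U : MatFun (Cube N) M c) :
      (MatFun.avg r (V.mul (R.stage r r))).mul (MatFun.avg r ((R.B r).mul U)) =
        (MatFun.avg r (V.mul (R'.stage r r))).mul (MatFun.avg r ((R'.B r).mul U)) := by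
    rw [← MatFun.avg_mul_lift, ← MatFun.avg_mul_lift, MatFun.mul_assoc, MatFun.mul_assoc]
    exact congrArg (fun W => MatFun.avg r (V.mul W)) (stage_mul_cavg_eq h hR hR' U)
  ext1 q
  have keyq {c n : ℕ} (V : MatFun (Cube N) n M) (U : MatFun (Cube N) M c) :=
    congrArg (fun F : MatFun (Rest r) n c => F q) (key V U)
  exact det_one_add_eq_of_intertwining (keyq (R.B r) (R.stage r r)) (keyq (R.B r) (R'.stage r r))
    (keyq (R'.B r) (R.stage r r)) (keyq (R'.B r) (R'.stage r r))

/-- `π(T)` does not depend on the representation of `T`: it is enough that the elimination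
procedure works for one representation. -/
lemma det_eq_of_op_eq {R R' : Rep N M} (h : R.op = R'.op) (hR : R.Regular N) :
    R'.det = R.det := by
  have hreg : ∀ r ≤ N, R'.Regular r := fun r => by
    induction r with
    | zero => exact fun _ => ⟨A₀_eq_of_op_eq h ▸ hR.1, fun j hj => absurd hj (Nat.not_lt_zero _)⟩
    | succ r ih =>
      intro hr
      have ih := ih (r.le_succ.trans hr)
      refine ⟨ih.1, fun j hj => ?_⟩
      rcases Nat.lt_succ_iff_lt_or_eq.1 hj with hj | rfl
      · exact ih.2 j hj
      · refine MatFun.isUnit_of_isUnit_det ?_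
        rw [← det_pivot_eq h ⟨hR.1, fun i _ => hR.2 i i.2⟩ ih]
        exact MatFun.isUnit_det (hR.2 j j.2)
  refine Prod.ext ?_ (funext fun j => ?_)
  · exact congrArg MatFun.det (A₀_eq_of_op_eq h).symm
  · exact (det_pivot_eq h ⟨hR.1, fun i _ => hR.2 i i.2⟩ (hreg j j.2.le)).symm

end Rep

lemma det_op {N M : ℕ} {R : Rep N M} (hR : R.Regular N) (hu : IsUnit R.op) :
    det R.op = R.det := by
  have h : R.op ∈ opSet N M ∧ IsUnit R.op := ⟨⟨R, rfl⟩, hu⟩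
  rw [det, dif_pos h]
  exact Rep.det_eq_of_op_eq h.1.choose_spec.symm hR

/-! ### The derivative at the identity -/

section Derivative

-- A submultiplicative norm turns the square matrix-valued functions into a Banach algebra, where
-- inversion is differentiable.
open scoped Matrix.Norms.L2Operator

namespace MatFun

section

variable {X : Type} [TopologicalSpace X] [CompactSpace X] {a b c : ℕ}

lemma norm_mul_le (A : MatFun X a b) (B : MatFun X b c) : ‖A.mul B‖ ≤ ‖A‖ * ‖B‖ := by
  refine (ContinuousMap.norm_le _ (by positivity)).2 fun k => ?_
  refine (Matrix.l2_opNorm_mul (A k) (B k)).trans ?_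
  gcongr
  · exact A.norm_coe_le_norm k
  · exact B.norm_coe_le_norm k

/-- The pointwise product as a continuous bilinear map. -/
def mulCLM (X : Type) [TopologicalSpace X] [CompactSpace X] (a b c : ℕ) :
    MatFun X a b →L[ℂ] MatFun X b c →L[ℂ] MatFun X a c :=
  LinearMap.mkContinuous₂
    (LinearMap.mk₂ ℂ MatFun.mul add_mul smul_mul mul_add fun t A B => mul_smul t A B) 1
    fun A B => by rw [_root_.one_mul]; exact norm_mul_le A B

lemma hasDerivAt_mul {f : ℂ → MatFun X a b} {g : ℂ → MatFun X b c} {f' : MatFun X a b}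
    {g' : MatFun X b c} {t : ℂ} (hf : HasDerivAt f f' t) (hg : HasDerivAt g g' t) :
    HasDerivAt (fun s => (f s).mul (g s)) ((f t).mul g' + f'.mul (g t)) t :=
  (mulCLM X a b c).hasDerivAt_of_bilinear (fun _ => hf) fun _ => hg

lemma hasDerivAt_mul_of_eq_zero {f : ℂ → MatFun X a b} {g : ℂ → MatFun X b c} {g' : MatFun X b c}
    {t : ℂ} (hf : DifferentiableAt ℂ f t) (hg : HasDerivAt g g' t) (h0 : g t = 0) :
    HasDerivAt (fun s => (f s).mul (g s)) ((f t).mul g') t := by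
  simpa only [h0, mul_zero, add_zero] using hasDerivAt_mul hf.hasDerivAt hg

/-- An entry of a matrix, as a continuous linear map. -/
def entryCLM (x : Fin a) (y : Fin b) : Matrix (Fin a) (Fin b) ℂ →L[ℂ] ℂ :=
  ⟨Matrix.entryLinearMap ℂ ℂ x y, continuous_id.matrix_elem x y⟩

/-- An entry of a matrix-valued function. -/
def entry (x : Fin a) (y : Fin b) (A : MatFun X a b) : C(X, ℂ) :=
  ⟨fun k => A k x y, A.continuous.matrix_elem x y⟩

lemma hasDerivAt_entry {f : ℂ → MatFun X a b} {f' : MatFun X a b} {t : ℂ}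
    (hf : HasDerivAt f f' t) (x : Fin a) (y : Fin b) :
    HasDerivAt (fun s => entry x y (f s)) (entry x y f') t :=
  ((entryCLM x y).compLeftContinuous ℂ X).hasFDerivAt.comp_hasDerivAt t hf

end

variable {N a b : ℕ}

/-- The extension of functions of the coordinates `i > j` to the cube, as a continuous linear
map. -/
def liftCLM (j : Fin N) (a b : ℕ) : MatFun (Rest j) a b →L[ℂ] MatFun (Cube N) a b :=
  LinearMap.mkContinuous
    { toFun := MatFun.lift j, map_add' := lift_add j, map_smul' := lift_smul j } 1 fun A => by
      rw [_root_.one_mul]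
      exact (ContinuousMap.norm_le _ (norm_nonneg _)).2 fun k => A.norm_coe_le_norm _

lemma norm_avg_le (j : Fin N) (A : MatFun (Cube N) a b) : ‖MatFun.avg j A‖ ≤ ‖A‖ := by
  refine (ContinuousMap.norm_le _ (norm_nonneg _)).2 fun q => ?_
  have hc : Continuous fun s : First j => A (glue j q s) :=
    A.continuous.comp ((continuous_glue j).comp (Continuous.prodMk_right q))
  have hi : Integrable fun s : First j => A (glue j q s) :=
    hc.integrable_of_hasCompactSupport (HasCompactSupport.of_compactSpace _)
  have h : MatFun.avg j A q = ∫ s : First j, A (glue j q s) := by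
    ext x y
    exact (entryCLM x y).integral_comp_comm hi
  rw [h]
  simpa using norm_integral_le_of_norm_le_const (μ := (volume : Measure (First j)))
    (Filter.Eventually.of_forall fun s => A.norm_coe_le_norm (glue j q s))

/-- The average `⟨·⟩`, as a continuous linear map. -/
def avgCLM (j : Fin N) (a b : ℕ) : MatFun (Cube N) a b →L[ℂ] MatFun (Rest j) a b :=
  LinearMap.mkContinuous
    { toFun := MatFun.avg j, map_add' := avg_add j, map_smul' := avg_smul j } 1 fun A => by
      rw [_root_.one_mul]; exact norm_avg_le j A

/-- The derivative of the determinant at the identity is the trace. -/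
lemma hasDerivAt_det {X : Type} [TopologicalSpace X] [CompactSpace X] {f : ℂ → MatFun X a a}
    {f' : MatFun X a a} {t : ℂ} (hf : HasDerivAt f f' t) (h1 : f t = 1) :
    HasDerivAt (fun s => (f s).det) f'.trace t := by
  have h : ∀ A : MatFun X a a,
      A.det = ∑ g : Equiv.Perm (Fin a), ((Equiv.Perm.sign g : ℤ) : ℂ) • ∏ i, entry (g i) i A := by
    intro A
    ext1 k
    simp [MatFun.det, Matrix.det_apply', entry]
  simp_rw [h]
  refine (HasDerivAt.fun_sum fun g _ => (HasDerivAt.fun_finsetProd fun i _ =>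
    hasDerivAt_entry hf (g i) i).const_smul ((Equiv.Perm.sign g : ℤ) : ℂ)).congr_deriv ?_
  have hone (x y : Fin a) (k : X) : entry x y (1 : MatFun X a a) k = if x = y then 1 else 0 :=
    Matrix.one_apply
  ext1 k
  simp only [h1, ContinuousMap.sum_apply, ContinuousMap.smul_apply, smul_eq_mul,
    ContinuousMap.mul_apply, ContinuousMap.prod_apply, hone]
  -- a permutation that fixes all indices but one is the identity
  rw [Finset.sum_eq_single 1]
  · simp [MatFun.trace, Matrix.trace, entry]
  · intro g _ hg
    rw [Finset.sum_eq_zero, MulZeroClass.mul_zero]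
    intro i _
    obtain ⟨j, hji, hj⟩ : ∃ j, j ≠ i ∧ g j ≠ j := by
      by_contra! hc
      have hi : g i = i := by
        by_contra hi
        exact hi (g.injective (hc _ hi))
      exact hg (Equiv.ext fun j => if hj : j = i then hj ▸ hi else hc j hj)
    rw [Finset.prod_eq_zero (Finset.mem_erase.2 ⟨hji, Finset.mem_univ j⟩) (if_neg hj),
      MulZeroClass.zero_mul]
  · simp

end MatFun

namespace Rep

variable {N M : ℕ}

/-- The representation of `1 + t T` obtained from a representation of `T`. -/
def oneAdd (R : Rep N M) (t : ℂ) : Rep N M where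
  size := R.size
  size_pos := R.size_pos
  A₀ := 1 + t • R.A₀
  A j := t • R.A j
  B := R.B

lemma partialOp_oneAdd (R : Rep N M) (t : ℂ) (r : ℕ) {c : ℕ} (U : MatFun (Cube N) M c) :
    (R.oneAdd t).partialOp r U = U + t • R.partialOp r U := by
  induction r with
  | zero => rw [partialOp, partialOp, oneAdd, MatFun.add_mul, MatFun.one_mul, MatFun.smul_mul]
  | succ r ih =>
    by_cases h : r < N
    · have ht : (R.oneAdd t).term ⟨r, h⟩ U = t • R.term ⟨r, h⟩ U := MatFun.smul_mul _ _ _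
      simp only [partialOp, ih, h, dite_true, ht, MatFun.smul_add, add_assoc]
    · simp [partialOp, ih, h]

lemma op_oneAdd (R : Rep N M) (t : ℂ) : (R.oneAdd t).op = 1 + t • R.op :=
  ext_toL2 fun U => by
    rw [op_toL2, partialOp_oneAdd, toL2_add, toL2_smul, ← op_toL2]
    rfl

lemma hasDerivAt_A₀ (R : Rep N M) : HasDerivAt (fun t => (R.oneAdd t).A₀) R.A₀ 0 := by
  have h := ((hasDerivAt_id (0 : ℂ)).smul_const R.A₀).const_add 1
  rwa [one_smul] at h

lemma oneAdd_zero_A₀ (R : Rep N M) : (R.oneAdd 0).A₀ = 1 := by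
  rw [oneAdd, MatFun.zero_smul, add_zero]

/-- The function `A_{j,r}` of the elimination procedure for `1 + t T`. -/
def stageAt (R : Rep N M) (t : ℂ) (r : ℕ) (j : Fin N) : MatFun (Cube N) M (R.size j) :=
  (R.oneAdd t).stage r j

/-- The matrix-valued function `E_j` of the elimination procedure for `1 + t T`. -/
def pivotAt (R : Rep N M) (t : ℂ) (j : Fin N) : MatFun (Rest j) (R.size j) (R.size j) :=
  (R.oneAdd t).pivot j

lemma stageAt_zero (R : Rep N M) (t : ℂ) (j : Fin N) :
    R.stageAt t 0 j = (Ring.inverse (R.oneAdd t).A₀).mul (t • R.A j) := rfl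

lemma stageAt_succ (R : Rep N M) (t : ℂ) (r j : Fin N) :
    R.stageAt t (r + 1) j = R.stageAt t r j - (R.stageAt t r r).mul
      (MatFun.lift r ((Ring.inverse (R.pivotAt t r)).mul
        (MatFun.avg r ((R.B r).mul (R.stageAt t r j))))) :=
  stage_succ _ r j

lemma stageAt_succ_of_le (R : Rep N M) (t : ℂ) {r : ℕ} (hr : ¬ r < N) (j : Fin N) :
    R.stageAt t (r + 1) j = R.stageAt t r j := by
  rw [stageAt, stage, dif_neg hr]
  rfl

lemma pivotAt_eq (R : Rep N M) (t : ℂ) (j : Fin N) :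
    R.pivotAt t j = 1 + MatFun.avg j ((R.B j).mul (R.stageAt t j j)) := rfl

lemma stageAt_at_zero (R : Rep N M) (r : ℕ) (j : Fin N) : R.stageAt 0 r j = 0 := by
  induction r with
  | zero => rw [stageAt_zero, MatFun.zero_smul, MatFun.mul_zero]
  | succ r ih =>
    by_cases hr : r < N
    · obtain ⟨r, rfl⟩ : ∃ i : Fin N, (i : ℕ) = r := ⟨⟨r, hr⟩, rfl⟩
      rw [stageAt_succ, ih, MatFun.mul_zero, MatFun.avg_zero, MatFun.mul_zero, MatFun.lift_zero,
        MatFun.mul_zero, sub_zero]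
    · rw [stageAt_succ_of_le _ _ hr, ih]

lemma pivotAt_at_zero (R : Rep N M) (j : Fin N) : R.pivotAt 0 j = 1 := by
  rw [pivotAt_eq, stageAt_at_zero, MatFun.mul_zero, MatFun.avg_zero, add_zero]

lemma hasDerivAt_avg_B_mul (R : Rep N M) (j : Fin N) {c : ℕ} {f : ℂ → MatFun (Cube N) M c}
    {f' : MatFun (Cube N) M c} (hf : HasDerivAt f f' 0) :
    HasDerivAt (fun t => MatFun.avg j ((R.B j).mul (f t))) (MatFun.avg j ((R.B j).mul f')) 0 := by
  have h := (((MatFun.avgCLM j _ _).comp (MatFun.mulCLM _ _ _ _ (R.B j))).hasFDerivAt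
    (x := f 0)).comp_hasDerivAt 0 hf
  exact h

lemma hasDerivAt_pivotAt (R : Rep N M) (j : Fin N)
    (h : HasDerivAt (fun t => R.stageAt t j j) (R.A j) 0) :
    HasDerivAt (fun t => R.pivotAt t j) (MatFun.avg j ((R.B j).mul (R.A j))) 0 :=
  (R.hasDerivAt_avg_B_mul j h).const_add 1

/-- To first order in `t`, the elimination procedure does not change the functions `t A_j`: the
correction terms are products of two factors that vanish at `t = 0`. -/
lemma hasDerivAt_stageAt (R : Rep N M) (r : ℕ) (j : Fin N) :
    HasDerivAt (fun t => R.stageAt t r j) (R.A j) 0 := by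
  induction r generalizing j with
  | zero =>
    have h1 : DifferentiableAt ℂ (fun t => Ring.inverse (R.oneAdd t).A₀) 0 :=
      R.hasDerivAt_A₀.differentiableAt.inverse (by rw [oneAdd_zero_A₀]; exact isUnit_one)
    have h2 : HasDerivAt (fun t : ℂ => t • R.A j) (R.A j) 0 := by
      have h := (hasDerivAt_id (0 : ℂ)).smul_const (R.A j)
      rwa [one_smul] at h
    have h3 := MatFun.hasDerivAt_mul_of_eq_zero h1 h2 (MatFun.zero_smul _)
    rwa [oneAdd_zero_A₀, Ring.inverse_one, MatFun.one_mul] at h3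
  | succ r ih =>
    by_cases hr : r < N
    · obtain ⟨r, rfl⟩ : ∃ i : Fin N, (i : ℕ) = r := ⟨⟨r, hr⟩, rfl⟩
      have h1 : DifferentiableAt ℂ (fun t => Ring.inverse (R.pivotAt t r)) 0 :=
        (R.hasDerivAt_pivotAt r (ih r)).differentiableAt.inverse
          (by rw [pivotAt_at_zero]; exact isUnit_one)
      have e : MatFun.avg r ((R.B r).mul (R.stageAt 0 r j)) = 0 := by
        rw [stageAt_at_zero, MatFun.mul_zero, MatFun.avg_zero]
      have h2 := MatFun.hasDerivAt_mul_of_eq_zero h1 (R.hasDerivAt_avg_B_mul r (ih j)) e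
      have h3 := ((MatFun.liftCLM r _ _).hasFDerivAt (x := _)).comp_hasDerivAt 0 h2
      have h4 := MatFun.hasDerivAt_mul_of_eq_zero (ih r).differentiableAt h3
        (by rw [Function.comp_apply, e, MatFun.mul_zero, map_zero])
      rw [stageAt_at_zero, MatFun.zero_mul] at h4
      have h5 := (ih j).sub h4
      rw [sub_zero] at h5
      exact h5.congr_of_eventuallyEq (Filter.Eventually.of_forall fun t => R.stageAt_succ t r j)
    · simpa only [stageAt_succ_of_le _ _ hr] using ih j

lemma eventually_regular (R : Rep N M) : ∀ᶠ t in nhds (0 : ℂ), (R.oneAdd t).Regular N := by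
  refine Filter.Eventually.and ?_ ?_
  · refine R.hasDerivAt_A₀.continuousAt.eventually (Units.isOpen.mem_nhds ?_)
    change IsUnit (R.oneAdd 0).A₀
    rw [oneAdd_zero_A₀]
    exact isUnit_one
  · have h : ∀ j : Fin N, ∀ᶠ t in nhds (0 : ℂ), IsUnit (R.pivotAt t j) := fun j => by
      refine (R.hasDerivAt_pivotAt j (R.hasDerivAt_stageAt j j)).continuousAt.eventually
        (Units.isOpen.mem_nhds ?_)
      change IsUnit (R.pivotAt 0 j)
      rw [pivotAt_at_zero]
      exact isUnit_one
    filter_upwards [Filter.eventually_all.2 h] with t ht j _ using ht j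

lemma trace_avg (j : Fin N) {a : ℕ} (A : MatFun (Cube N) a a) :
    (MatFun.avg j A).trace = avg j A.trace := by
  ext1 q
  exact (integral_finsetSum Finset.univ fun x _ =>
    integrable_comp_glue j q (A.continuous_entry x x)).symm

lemma hasDerivAt_det_oneAdd (R : Rep N M) : HasDerivAt (fun t => (R.oneAdd t).det) R.trace 0 := by
  refine HasDerivAt.prodMk ?_ (hasDerivAt_pi.2 fun j => ?_)
  · exact MatFun.hasDerivAt_det R.hasDerivAt_A₀ R.oneAdd_zero_A₀
  · rw [← trace_avg]
    exact MatFun.hasDerivAt_det (R.hasDerivAt_pivotAt j (R.hasDerivAt_stageAt j j))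
      (R.pivotAt_at_zero j)

lemma eventually_det (R : Rep N M) :
    (fun t : ℂ => PeriodicOp.det (1 + t • R.op)) =ᶠ[nhds 0] fun t => (R.oneAdd t).det := by
  have hc : ContinuousAt (fun t : ℂ => 1 + t • R.op) 0 := by fun_prop
  have hu : ∀ᶠ t in nhds (0 : ℂ), IsUnit (1 + t • R.op) :=
    hc.eventually (Units.isOpen.mem_nhds (by simp))
  filter_upwards [R.eventually_regular, hu] with t h1 h2
  rw [← op_oneAdd] at h2 ⊢
  exact det_op h1 h2

lemma hasDerivAt_det (R : Rep N M) :
    HasDerivAt (fun t : ℂ => PeriodicOp.det (1 + t • R.op)) R.trace 0 :=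
  R.hasDerivAt_det_oneAdd.congr_of_eventuallyEq R.eventually_det

lemma trace_op (R : Rep N M) : PeriodicOp.trace R.op = R.trace := R.hasDerivAt_det.deriv

end Rep

end Derivative

/-! ### Linear combinations of representations -/

namespace MatFun

variable {X : Type} [TopologicalSpace X] {a b b' c : ℕ}

/-- The block row `(A A')`. -/
def hcat (A : MatFun X a b) (A' : MatFun X a b') : MatFun X a (b + b') :=
  ⟨fun k => Matrix.of fun x => Fin.append (A k x) (A' k x),
    continuous_matrix fun x y => by
      refine Fin.addCases (fun z => ?_) (fun z => ?_) y
      · simpa using A.continuous.matrix_elem x z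
      · simpa using A'.continuous.matrix_elem x z⟩

/-- The block column `(B; B')`. -/
def vcat (B : MatFun X b a) (B' : MatFun X b' a) : MatFun X (b + b') a :=
  ⟨fun k => Matrix.of fun y x => Fin.append (fun i => B k i x) (fun i => B' k i x) y,
    continuous_matrix fun y x => by
      refine Fin.addCases (fun z => ?_) (fun z => ?_) y
      · simpa using B.continuous.matrix_elem z x
      · simpa using B'.continuous.matrix_elem z x⟩

lemma hcat_mul_vcat (A : MatFun X a b) (A' : MatFun X a b') (V : MatFun X b c)
    (V' : MatFun X b' c) : (hcat A A').mul (vcat V V') = A.mul V + A'.mul V' := by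
  ext k x y
  simp [hcat, vcat, Matrix.mul_apply, Fin.sum_univ_add]

lemma vcat_mul (B : MatFun X b a) (B' : MatFun X b' a) (U : MatFun X a c) :
    (vcat B B').mul U = vcat (B.mul U) (B'.mul U) := by
  ext k y x
  refine Fin.addCases (fun z => ?_) (fun z => ?_) y <;> simp [vcat, Matrix.mul_apply]

lemma trace_vcat_mul_hcat (A : MatFun X a b) (A' : MatFun X a b') (B : MatFun X b a)
    (B' : MatFun X b' a) :
    ((vcat B B').mul (hcat A A')).trace = (B.mul A).trace + (B'.mul A').trace := by
  ext k
  simp [MatFun.trace, hcat, vcat, Matrix.trace, Matrix.mul_apply, Fin.sum_univ_add]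

lemma trace_mul_comm (A : MatFun X a b) (B : MatFun X b a) :
    (A.mul B).trace = (B.mul A).trace := by
  ext1 k
  exact Matrix.trace_mul_comm (A k) (B k)

lemma cavg_vcat {N : ℕ} (j : Fin N) (B : MatFun (Cube N) b a) (B' : MatFun (Cube N) b' a) :
    cavg j (vcat B B') = vcat (cavg j B) (cavg j B') := by
  ext k y x
  refine Fin.addCases (fun z => ?_) (fun z => ?_) y <;> simp [vcat, cavg]

end MatFun

lemma avg_add {N : ℕ} (j : Fin N) (f g : C(Cube N, ℂ)) : avg j (f + g) = avg j f + avg j g := by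
  ext q
  exact integral_add (integrable_comp_glue j q f.continuous) (integrable_comp_glue j q g.continuous)

lemma avg_smul {N : ℕ} (j : Fin N) (t : ℂ) (f : C(Cube N, ℂ)) : avg j (t • f) = t • avg j f := by
  ext q
  exact integral_const_mul t _

namespace Rep

variable {N M : ℕ}

/-- The sum of two representations: the inner sizes add up. -/
def add (R S : Rep N M) : Rep N M where
  size j := R.size j + S.size j
  size_pos j := Nat.add_pos_left (R.size_pos j) _
  A₀ := R.A₀ + S.A₀
  A j := MatFun.hcat (R.A j) (S.A j)
  B j := MatFun.vcat (R.B j) (S.B j)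

/-- The multiple of a representation. -/
def smul (t : ℂ) (R : Rep N M) : Rep N M where
  size := R.size
  size_pos := R.size_pos
  A₀ := t • R.A₀
  A j := t • R.A j
  B := R.B

lemma term_add (R S : Rep N M) (j : Fin N) {c : ℕ} (U : MatFun (Cube N) M c) :
    (R.add S).term j U = R.term j U + S.term j U := by
  rw [term, add, MatFun.vcat_mul, MatFun.cavg_vcat, MatFun.hcat_mul_vcat]
  rfl

lemma partialOp_add_rep (R S : Rep N M) (r : ℕ) {c : ℕ} (U : MatFun (Cube N) M c) :
    (R.add S).partialOp r U = R.partialOp r U + S.partialOp r U := by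
  induction r with
  | zero => exact MatFun.add_mul _ _ _
  | succ r ih =>
    by_cases h : r < N
    · simp only [partialOp, ih, h, dite_true, term_add]
      abel
    · simp [partialOp, ih, h]

lemma partialOp_smul_rep (t : ℂ) (R : Rep N M) (r : ℕ) {c : ℕ} (U : MatFun (Cube N) M c) :
    (R.smul t).partialOp r U = t • R.partialOp r U := by
  induction r with
  | zero => exact MatFun.smul_mul _ _ _
  | succ r ih =>
    by_cases h : r < N
    · have ht : (R.smul t).term ⟨r, h⟩ U = t • R.term ⟨r, h⟩ U := MatFun.smul_mul _ _ _
      simp only [partialOp, ih, h, dite_true, ht, MatFun.smul_add]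
    · simp [partialOp, ih, h]

lemma op_add (R S : Rep N M) : (R.add S).op = R.op + S.op :=
  ext_toL2 fun U => by
    rw [op_toL2, partialOp_add_rep, toL2_add, ← op_toL2, ← op_toL2]
    rfl

lemma op_smul (t : ℂ) (R : Rep N M) : (R.smul t).op = t • R.op :=
  ext_toL2 fun U => by
    rw [op_toL2, partialOp_smul_rep, toL2_smul, ← op_toL2]
    rfl

lemma trace_add (R S : Rep N M) : (R.add S).trace = R.trace + S.trace := by
  refine Prod.ext ?_ (funext fun j => ?_)
  · ext1 k
    exact Matrix.trace_add (R.A₀ k) (S.A₀ k)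
  · change avg j ((MatFun.vcat _ _).mul (MatFun.hcat _ _)).trace = _
    rw [MatFun.trace_vcat_mul_hcat, avg_add]
    rfl

lemma trace_smul (t : ℂ) (R : Rep N M) : (R.smul t).trace = t • R.trace := by
  refine Prod.ext ?_ (funext fun j => ?_)
  · ext1 k
    exact Matrix.trace_smul t (R.A₀ k)
  · change avg j ((R.B j).mul (t • R.A j)).trace = t • avg j ((R.B j).mul (R.A j)).trace
    rw [MatFun.mul_smul, ← avg_smul]
    congr 1
    ext1 k
    exact Matrix.trace_smul t (R.B j k * R.A j k)

end Rep

section Linear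

variable {N M : ℕ} {T S : L2 N M →L[ℂ] L2 N M}

lemma add_mem_opSet (hT : T ∈ opSet N M) (hS : S ∈ opSet N M) : T + S ∈ opSet N M := by
  obtain ⟨R, rfl⟩ := hT
  obtain ⟨R', rfl⟩ := hS
  exact ⟨R.add R', R.op_add R'⟩

lemma smul_mem_opSet (t : ℂ) (hT : T ∈ opSet N M) : t • T ∈ opSet N M := by
  obtain ⟨R, rfl⟩ := hT
  exact ⟨R.smul t, R.op_smul t⟩

lemma trace_add (hT : T ∈ opSet N M) (hS : S ∈ opSet N M) : trace (T + S) = trace T + trace S := by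
  obtain ⟨R, rfl⟩ := hT
  obtain ⟨R', rfl⟩ := hS
  rw [← Rep.op_add, Rep.trace_op, Rep.trace_op, Rep.trace_op, Rep.trace_add]

lemma trace_smul (t : ℂ) (hT : T ∈ opSet N M) : trace (t • T) = t • trace T := by
  obtain ⟨R, rfl⟩ := hT
  rw [← Rep.op_smul, Rep.trace_op, Rep.trace_op, Rep.trace_smul]

end Linear

/-! ### The trace of a product -/

section Product

variable {N M : ℕ}

/-- The operator `u ↦ A ⟨B u⟩_j`. -/
def termOp {m : ℕ} (j : Fin N) (A : MatFun (Cube N) M m) (B : MatFun (Cube N) m M) :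
    L2 N M →L[ℂ] L2 N M :=
  (mulOp A).comp ((avgOp j).comp (mulOp B))

lemma termOp_toL2 {m c : ℕ} (j : Fin N) (A : MatFun (Cube N) M m) (B : MatFun (Cube N) m M)
    (U : MatFun (Cube N) M c) (y : Fin c) :
    termOp j A B (toL2 U y) = toL2 (A.mul (MatFun.cavg j (B.mul U))) y := by
  rw [termOp, ContinuousLinearMap.comp_apply, ContinuousLinearMap.comp_apply, mulOp_toL2,
    avgOp_toL2, mulOp_toL2]

lemma mulOp_zero {a b : ℕ} : mulOp (0 : MatFun (Cube N) a b) = 0 :=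
  ext_toL2 fun U => by
    rw [mulOp_toL2, MatFun.zero_mul, toL2_zero]
    rfl

lemma mulOp_comp {a b c : ℕ} (A : MatFun (Cube N) a b) (B : MatFun (Cube N) b c) :
    (mulOp A).comp (mulOp B) = mulOp (A.mul B) :=
  ext_toL2 fun U => by
    rw [ContinuousLinearMap.comp_apply, mulOp_toL2, mulOp_toL2, mulOp_toL2, MatFun.mul_assoc]

/-- For `i ≤ j` the factor `⟨B' u⟩_j` can be taken out of the inner average. -/
lemma termOp_comp_termOp_of_le {m m' : ℕ} {i j : Fin N} (hij : i ≤ j) (A : MatFun (Cube N) M m)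
    (B : MatFun (Cube N) m M) (A' : MatFun (Cube N) M m') (B' : MatFun (Cube N) m' M) :
    (termOp i A B).comp (termOp j A' B') =
      termOp j (A.mul (MatFun.cavg i (B.mul A'))) B' :=
  ext_toL2 fun U => by
    rw [ContinuousLinearMap.comp_apply, termOp_toL2, termOp_toL2, termOp_toL2,
      ← MatFun.mul_assoc B, MatFun.cavg_mul_of_indepBelow, MatFun.mul_assoc]
    exact (MatFun.indepBelow_lift j _).mono (Nat.succ_le_succ hij)

/-- For `i ≤ j` the tower property of the averages moves the inner average to the other factor. -/
lemma termOp_comp_termOp_of_ge {m m' : ℕ} {i j : Fin N} (hij : i ≤ j) (A : MatFun (Cube N) M m)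
    (B : MatFun (Cube N) m M) (A' : MatFun (Cube N) M m') (B' : MatFun (Cube N) m' M) :
    (termOp j A' B').comp (termOp i A B) =
      termOp j A' ((MatFun.cavg i (B'.mul A)).mul B) :=
  ext_toL2 fun U => by
    rw [ContinuousLinearMap.comp_apply, termOp_toL2, termOp_toL2, termOp_toL2,
      ← MatFun.mul_assoc B', MatFun.cavg, MatFun.avg_mul_cavg hij, MatFun.mul_assoc]
    rfl

namespace Rep

/-- The representation of a multiplication operator. -/
def ofMul (A : MatFun (Cube N) M M) : Rep N M where
  size _ := 1
  size_pos _ := one_pos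
  A₀ := A
  A _ := 0
  B _ := 0

/-- The representation of the operator `u ↦ A ⟨B u⟩_j`. -/
def single {m : ℕ} (hm : 0 < m) (j : Fin N) (A : MatFun (Cube N) M m) (B : MatFun (Cube N) m M) :
    Rep N M where
  size _ := m
  size_pos _ := hm
  A₀ := 0
  A i := if i = j then A else 0
  B _ := B

lemma op_ofMul (A : MatFun (Cube N) M M) : (ofMul A).op = mulOp A := by
  refine add_eq_left.2 (Finset.sum_eq_zero fun j _ => ?_)
  change (mulOp 0).comp _ = 0
  rw [mulOp_zero, ContinuousLinearMap.zero_comp]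

lemma op_single {m : ℕ} (hm : 0 < m) (j : Fin N) (A : MatFun (Cube N) M m)
    (B : MatFun (Cube N) m M) : (single hm j A B).op = termOp j A B := by
  have h : (single hm j A B).op =
      mulOp 0 + ∑ i : Fin N, (mulOp (if i = j then A else 0)).comp ((avgOp i).comp (mulOp B)) := rfl
  rw [h, mulOp_zero, zero_add, Finset.sum_eq_single j]
  · rw [if_pos rfl]
    rfl
  · intro i _ hi
    rw [if_neg hi, mulOp_zero, ContinuousLinearMap.zero_comp]
  · simp

lemma trace_single_eq {m m' : ℕ} (hm : 0 < m) (hm' : 0 < m') (j : Fin N)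
    {A : MatFun (Cube N) M m} {B : MatFun (Cube N) m M} {A' : MatFun (Cube N) M m'}
    {B' : MatFun (Cube N) m' M} (h : avg j (B.mul A).trace = avg j (B'.mul A').trace) :
    (single hm j A B).trace = (single hm' j A' B').trace := by
  refine Prod.ext rfl (funext fun i => ?_)
  by_cases hi : i = j
  · subst hi
    simpa [trace, single] using h
  · have h0 {n : ℕ} : (0 : MatFun (Cube N) n n).trace = 0 := by
      ext1 k
      exact Matrix.trace_zero (Fin n) ℂ
    simp [trace, single, hi, h0]

end Rep

/-- Both products of `T` and `S` lie in `ℋ` and have the same trace. -/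
def TraceComm (T S : L2 N M →L[ℂ] L2 N M) : Prop :=
  T.comp S ∈ opSet N M ∧ S.comp T ∈ opSet N M ∧ trace (T.comp S) = trace (S.comp T)

namespace TraceComm

variable {T T' S : L2 N M →L[ℂ] L2 N M}

lemma symm (h : TraceComm T S) : TraceComm S T := ⟨h.2.1, h.1, h.2.2.symm⟩

lemma of_rep {R R' : Rep N M} (h : T.comp S = R.op) (h' : S.comp T = R'.op)
    (ht : R.trace = R'.trace) : TraceComm T S :=
  ⟨⟨R, h.symm⟩, ⟨R', h'.symm⟩, by rw [h, h', Rep.trace_op, Rep.trace_op, ht]⟩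

lemma add (h : TraceComm T S) (h' : TraceComm T' S) : TraceComm (T + T') S := by
  unfold TraceComm
  rw [ContinuousLinearMap.add_comp, ContinuousLinearMap.comp_add, trace_add h.1 h'.1,
    trace_add h.2.1 h'.2.1, h.2.2, h'.2.2]
  exact ⟨add_mem_opSet h.1 h'.1, add_mem_opSet h.2.1 h'.2.1, rfl⟩

lemma zero : TraceComm 0 S := by
  have h0 : (0 : L2 N M →L[ℂ] L2 N M) = (Rep.ofMul 0).op := by rw [Rep.op_ofMul, mulOp_zero]
  exact of_rep ((ContinuousLinearMap.zero_comp S).trans h0)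
    ((ContinuousLinearMap.comp_zero S).trans h0) rfl

/-- By additivity it is enough to treat the summands of a representation. -/
lemma op_left (R : Rep N M) (h₀ : TraceComm (mulOp R.A₀) S)
    (h : ∀ j, TraceComm (termOp j (R.A j) (R.B j)) S) : TraceComm R.op S := by
  refine h₀.add ?_
  exact Finset.sum_induction _ (fun T => TraceComm T S) (fun _ _ => add) zero fun j _ => h j

lemma mulOp_mulOp (A A' : MatFun (Cube N) M M) : TraceComm (mulOp A) (mulOp A') :=
  of_rep ((mulOp_comp A A').trans (Rep.op_ofMul _).symm)
    ((mulOp_comp A' A).trans (Rep.op_ofMul _).symm)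
    (Prod.ext (MatFun.trace_mul_comm A A') rfl)

lemma mulOp_termOp {m : ℕ} (hm : 0 < m) (A₀ : MatFun (Cube N) M M) (j : Fin N)
    (A : MatFun (Cube N) M m) (B : MatFun (Cube N) m M) :
    TraceComm (mulOp A₀) (termOp j A B) := by
  refine of_rep (R := Rep.single hm j (A₀.mul A) B) (R' := Rep.single hm j A (B.mul A₀)) ?_ ?_
    (Rep.trace_single_eq _ _ _ (by rw [MatFun.mul_assoc]))
  · rw [Rep.op_single, termOp, termOp, ← mulOp_comp]
    rfl
  · rw [Rep.op_single, termOp, termOp, ← mulOp_comp]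
    rfl

lemma termOp_termOp_of_le {m m' : ℕ} (hm' : 0 < m') {i j : Fin N} (hij : i ≤ j)
    (A : MatFun (Cube N) M m) (B : MatFun (Cube N) m M) (A' : MatFun (Cube N) M m')
    (B' : MatFun (Cube N) m' M) : TraceComm (termOp i A B) (termOp j A' B') := by
  refine of_rep ((termOp_comp_termOp_of_le hij A B A' B').trans (Rep.op_single hm' _ _ _).symm)
    ((termOp_comp_termOp_of_ge hij A B A' B').trans (Rep.op_single hm' _ _ _).symm)
    (Rep.trace_single_eq _ _ _ ?_)
  rw [← Rep.trace_avg, ← Rep.trace_avg, ← MatFun.mul_assoc, MatFun.avg_mul_cavg hij,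
    MatFun.mul_assoc]

lemma op_op (R R' : Rep N M) : TraceComm R.op R'.op := by
  refine op_left R (op_left R' (mulOp_mulOp _ _) fun j => ?_).symm fun i =>
    (op_left R' (mulOp_termOp (R.size_pos i) _ _ _ _) fun j => ?_).symm
  · exact (mulOp_termOp (R'.size_pos j) _ _ _ _).symm
  · rcases le_total i j with hij | hij
    · exact (termOp_termOp_of_le (R'.size_pos j) hij _ _ _ _).symm
    · exact termOp_termOp_of_le (R.size_pos i) hij _ _ _ _

end TraceComm

end Product

end PeriodicOp

end

theorem theorem5 (N M : ℕ) :
    -- the derivative defining `τ` exists, and `τ` is given by the explicit formula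
    (∀ R : PeriodicOp.Rep N M,
      DifferentiableAt ℂ (fun t : ℂ => PeriodicOp.det (1 + t • R.op)) 0 ∧
        PeriodicOp.trace R.op = R.trace) ∧
    -- `τ` is linear
    (∀ T ∈ PeriodicOp.opSet N M, ∀ S ∈ PeriodicOp.opSet N M, ∀ α β : ℂ,
      PeriodicOp.trace (α • T + β • S) = α • PeriodicOp.trace T + β • PeriodicOp.trace S) ∧
    -- `τ(T ∘ S) = τ(S ∘ T)`
    (∀ T ∈ PeriodicOp.opSet N M, ∀ S ∈ PeriodicOp.opSet N M,
      PeriodicOp.trace (T.comp S) = PeriodicOp.trace (S.comp T)) := by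
  refine ⟨fun R => ⟨R.hasDerivAt_det.differentiableAt, R.trace_op⟩, fun T hT S hS α β => ?_, ?_⟩
  · rw [PeriodicOp.trace_add (PeriodicOp.smul_mem_opSet α hT) (PeriodicOp.smul_mem_opSet β hS),
      PeriodicOp.trace_smul α hT, PeriodicOp.trace_smul β hS]
  · rintro _ ⟨R, rfl⟩ _ ⟨R', rfl⟩
    exact (PeriodicOp.TraceComm.op_op R R').2.2
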